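/- Let $\mathbb K$ be a field of positive characteristic $p$ and let $n\ge 1$. Write ${\mathcal V}$ for the category of finite-dimensional $\mathbb K$-vector spaces and ${}_{\mathfrak S_n}{\mathcal V}$ for the category of finite-dimensional $\mathbb K[\mathfrak S_n]$-modules. A $\mathbb K$-linear functor $f:{}_{\mathfrak S_n}{\mathcal V}\to{\mathcal V}$ is coherent if there is an exact sequence of functors $h_N\to h_M\to f\to 0$ with $M,N\in{}_{\mathfrak S_n}{\mathcal V}$, where $h_M=\mathrm{Hom}_{\mathfrak S_n}(M,-)$. Let ${\mathcal C}_n$ be the category of coherent functors and natural transformations. For a vector space $X$ put $\Gamma^n(X)=(X^{\otimes n})^{\mathfrak S_n}$, where $\mathfrak S_n$ permutes the factors. Let $\Gamma^n{\mathcal V}$ be the $\mathbb K$-linear category whose objects are the finite-dimensional vector spaces and whose morphisms $V\to W$ are the elements of $\Gamma^n(\mathrm{Hom}(V,W))$; composition is induced by $(g_1\otimes\cdots\otimes g_n,\ f_1\otimes\cdots\otimes f_n)\mapsto g_1f_1\otimes\cdots\otimes g_nf_n$. Let ${\mathcal P}_n$ be the category of homogeneous strict polynomial functors of degree $n$, i.e.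 of $\mathbb K$-linear functors $\Gamma^n{\mathcal V}\to{\mathcal V}$ and natural transformations. Precomposition with the $\mathbb K$-linear functor $\Gamma^n{\mathcal V}\to{}_{\mathfrak S_n}{\mathcal V}$, $V\mapsto V^{\otimes n}$, defines a functor $j^*:{\mathcal C}_n\to{\mathcal P}_n$, $j^*(f)(V)=f(V^{\otimes n})$. For a partition $\lambda=(n_1\ge\cdots\ge n_k)$ of $n$ let $\mathfrak S_\lambda\subseteq\mathfrak S_n$ be the Young subgroup, i.e. the stabilizer of the consecutive blocks of lengths $n_1,\dots,n_k$. Let ${\mathcal C}_n^{\mathsf Y}$ be the full subcategory of ${\mathcal C}_n$ on the coherent functors $f$ such that $f(\mathbb K[\mathfrak S_n/\mathfrak S_\lambda])=0$ for all partitions $\lambda$ of $n$, and let $i_*:{\mathcal C}_n^{\mathsf Y}\to{\mathcal C}_n$ be the inclusion. Then ${\mathcal C}_n^{\mathsf Y}$, ${\mathcal C}_n$ and ${\mathcal P}_n$ are abelian categories and $j^*$ is exact. A coherent functor $f$ satisfies $j^*(f)=0$ if and only if $f(\mathbb K[\mathfrak S_n/\mathfrak S_\lambda])=0$ for all partitions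 $\lambda$ of $n$. Moreover, the functor $j^*$ has a left adjoint $j_!$ and a right adjoint $j_*$, and these are part of a recollement of abelian categories $${\mathcal C}_n^{\mathsf Y}\ \xrightarrow{\ i_*\ }\ {\mathcal C}_n\ \xrightarrow{\ j^*\ }\ {\mathcal P}_n .$$ That is, there are additive functors $i^*,i^!:{\mathcal C}_n\to{\mathcal C}_n^{\mathsf Y}$ and $j_!,j_*:{\mathcal P}_n\to{\mathcal C}_n$ such that 1. $j_!$ is left adjoint to $j^*$ and $j_*$ is right adjoint to $j^*$; 2. the unit $\mathrm{Id}\to j^*j_!$ and the counit $j^*j_*\to\mathrm{Id}$ are isomorphisms; 3. $i^*$ is left adjoint to $i_*$ and $i^!$ is right adjoint to $i_*$; 4. the unit $\mathrm{Id}\to i^!i_*$ and the counit $i^*i_*\to\mathrm{Id}$ are isomorphisms; 5. $i_*$ is an equivalence from ${\mathcal C}_n^{\mathsf Y}$ onto the kernel of $j^*$, the full subcategory of ${\mathcal C}_n$ on the objects $f$ with $j^*(f)=0$. (The functors $i_*$ and $j^*$ are additive as well.) -/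

import Mathlib

open CategoryTheory CategoryTheory.Limits TensorProduct

universe u

noncomputable section

namespace CoherentPoly

/-! ## Abelian categories, exact functors, recollements -/

/-- The preadditive category `C` is abelian (with the given addition of morphisms). -/
def IsAbelianCategory (C : Type*) [Category C] [P : Preadditive C] : Prop :=
  ∃ h : Abelian C, h.toPreadditive = P

/-- An exact functor: it preserves finite limits and finite colimits. -/
def IsExactFunctor {A B : Type*} [Category A] [Category B] (F : A ⥤ B) : Prop :=
  PreservesFiniteLimits F ∧ PreservesFiniteColimits F

/-- The kernel of a functor: the objects that are sent to a zero object. -/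
def functorKernel {A B : Type*} [Category A] [Category B] (F : A ⥤ B) : ObjectProperty A :=
  fun X => IsZero (F.obj X)

/-- The data and the conditions that complete two functors `i_* : A' ⥤ A` and `j^* : A ⥤ A''`
to a recollement
`A' ⇄ A ⇄ A''` with adjoint triples `i^* ⊣ i_* ⊣ i^!` and `j_! ⊣ j^* ⊣ j_*`. -/
structure Recollement {A' A A'' : Type*} [Category A'] [Category A] [Category A'']
    [Preadditive A'] [Preadditive A] [Preadditive A'']
    (iLower : A' ⥤ A) (jUpper : A ⥤ A'') where
  /-- the functor `i^*` -/
  iUpper : A ⥤ A'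
  /-- the functor `i^!` -/
  iShriek : A ⥤ A'
  /-- the functor `j_!` -/
  jShriek : A'' ⥤ A
  /-- the functor `j_*` -/
  jLower : A'' ⥤ A
  additive_iLower : iLower.Additive
  additive_jUpper : jUpper.Additive
  additive_iUpper : iUpper.Additive
  additive_iShriek : iShriek.Additive
  additive_jShriek : jShriek.Additive
  additive_jLower : jLower.Additive
  /-- `j_!` is left adjoint to `j^*` -/
  adjJShriek : jShriek ⊣ jUpper
  /-- `j_*` is right adjoint to `j^*` -/
  adjJLower : jUpper ⊣ jLower
  /-- the unit `Id ⟶ j^* j_!` is an isomorphism -/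
  isIso_unit_j : IsIso adjJShriek.unit
  /-- the counit `j^* j_* ⟶ Id` is an isomorphism -/
  isIso_counit_j : IsIso adjJLower.counit
  /-- `i^*` is left adjoint to `i_*` -/
  adjIUpper : iUpper ⊣ iLower
  /-- `i^!` is right adjoint to `i_*` -/
  adjIShriek : iLower ⊣ iShriek
  /-- the unit `Id ⟶ i^! i_*` is an isomorphism -/
  isIso_unit_i : IsIso adjIShriek.unit
  /-- the counit `i^* i_* ⟶ Id` is an isomorphism -/
  isIso_counit_i : IsIso adjIUpper.counit
  /-- `i_*` takes values in the kernel of `j^*` -/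
  mem_kernel : ∀ X : A', functorKernel jUpper (iLower.obj X)
  /-- `i_*` is an equivalence of `A'` with the kernel of `j^*` -/
  isEquivalence : ((functorKernel jUpper).lift iLower mem_kernel).IsEquivalence

/-! ## Linear functors and coherent functors -/

/-- `K`-linear functors with values in finite-dimensional vector spaces. -/
def isLinear (K : Type u) [Field K] (C : Type*) [Category C] [Preadditive C] [Linear K C] :
    ObjectProperty (C ⥤ FGModuleCat.{u} K) :=
  fun F => F.Additive ∧ F.Linear K

section Coherent

variable (K : Type u) [Field K] (G : Type) [Group G]

/-- The functor `h_M = Hom_G(M, -)` from finite-dimensional `G`-modules to finite-dimensional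
vector spaces. -/
def hFunctor (M : FDRep K G) : FDRep K G ⥤ FGModuleCat.{u} K :=
  (ModuleCat.isFG K).lift ((linearCoyoneda K (FDRep K G)).obj (Opposite.op M))
    (fun X => inferInstanceAs (Module.Finite K (M ⟶ X)))

/-- Coherent functors on finite-dimensional `G`-modules: the `K`-linear functors `f` that fit in
an exact sequence `h_N ⟶ h_M ⟶ f ⟶ 0` of functors. -/
def isCoherent : ObjectProperty (FDRep K G ⥤ FGModuleCat.{u} K) := fun f =>
  isLinear K (FDRep K G) f ∧
    ∃ (M N : FDRep K G) (α : hFunctor K G N ⟶ hFunctor K G M) (π : hFunctor K G M ⟶ f),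
      ∀ X : FDRep K G,
        Function.Exact (α.app X).hom.hom (π.app X).hom.hom ∧
          Function.Surjective (π.app X).hom.hom

/-- The category `C(G)` of coherent functors and natural transformations. -/
abbrev CoherentFunctor := (isCoherent K G).FullSubcategory

end Coherent

/-! ## Divided powers and the category `Γⁿ V` -/

section Gamma

variable (K : Type u) [Field K] (n : ℕ)

/-- The action of the symmetric group on `V^{⊗ n}` by permuting the factors:
`σ (v₁ ⊗ ⋯ ⊗ vₙ) = v_{σ⁻¹ 1} ⊗ ⋯ ⊗ v_{σ⁻¹ n}`. -/
def tensorRep (V : Type*) [AddCommGroup V] [Module K V] :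
    Representation K (Equiv.Perm (Fin n)) (⨂[K] _ : Fin n, V) where
  toFun σ := (PiTensorProduct.reindex K (fun _ : Fin n => V) σ).toLinearMap
  map_one' := by
    refine PiTensorProduct.ext (MultilinearMap.ext fun v => ?_)
    simp
    rfl
  map_mul' σ τ := by
    refine PiTensorProduct.ext (MultilinearMap.ext fun v => ?_)
    simp
    rfl

variable {n}

@[simp]
lemma tensorRep_tprod (V : Type*) [AddCommGroup V] [Module K V] (σ : Equiv.Perm (Fin n))
    (v : Fin n → V) :
    tensorRep K n V σ (PiTensorProduct.tprod K v) =
      PiTensorProduct.tprod K (fun i => v (σ.symm i)) :=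
  PiTensorProduct.reindex_tprod (R := K) (s := fun _ => V) σ v

variable (n)

/-- The divided power `Γⁿ(V)`, the invariants of the symmetric group in `V^{⊗ n}`. -/
def dividedPower (V : Type*) [AddCommGroup V] [Module K V] :
    Submodule K (⨂[K] _ : Fin n, V) :=
  (tensorRep K n V).invariants

variable {n} {K}

section
variable {U V W X : Type*} [AddCommGroup U] [Module K U] [AddCommGroup V] [Module K V]
  [AddCommGroup W] [Module K W] [AddCommGroup X] [Module K X]

/-- The bilinear map `Hom(V, W)^{⊗ n} × Hom(U, V)^{⊗ n} → Hom(U, W)^{⊗ n}` that reorders the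
factors and composes: `(g₁ ⊗ ⋯ ⊗ gₙ, f₁ ⊗ ⋯ ⊗ fₙ) ↦ g₁f₁ ⊗ ⋯ ⊗ gₙfₙ`. -/
def tensorComp : (⨂[K] _ : Fin n, (V →ₗ[K] W)) →ₗ[K] (⨂[K] _ : Fin n, (U →ₗ[K] V)) →ₗ[K]
    (⨂[K] _ : Fin n, (U →ₗ[K] W)) :=
  PiTensorProduct.map₂ (fun _ => LinearMap.llcomp K U V W)

lemma tensorComp_tprod (g : Fin n → (V →ₗ[K] W)) (f : Fin n → (U →ₗ[K] V)) :
    tensorComp (PiTensorProduct.tprod K g) (PiTensorProduct.tprod K f) =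
      PiTensorProduct.tprod K (fun i => g i ∘ₗ f i) :=
  PiTensorProduct.map₂_tprod_tprod _ g f

/-- `tensorComp` commutes with the actions of the symmetric group. -/
lemma tensorComp_tensorRep (σ : Equiv.Perm (Fin n)) (x : ⨂[K] _ : Fin n, (V →ₗ[K] W))
    (y : ⨂[K] _ : Fin n, (U →ₗ[K] V)) :
    tensorComp (tensorRep K n _ σ x) (tensorRep K n _ σ y) =
      tensorRep K n _ σ (tensorComp x y) := by
  induction x using PiTensorProduct.induction_on with
  | smul_tprod r g =>
    induction y using PiTensorProduct.induction_on with
    | smul_tprod s f => simp [tensorComp_tprod]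
    | add y y' hy hy' => simp only [map_add, hy, hy']
  | add x x' hx hx' => simp only [map_add, LinearMap.add_apply, hx, hx']

lemma tensorComp_assoc (x : ⨂[K] _ : Fin n, (W →ₗ[K] X)) (y : ⨂[K] _ : Fin n, (V →ₗ[K] W))
    (z : ⨂[K] _ : Fin n, (U →ₗ[K] V)) :
    tensorComp x (tensorComp y z) = tensorComp (tensorComp x y) z := by
  induction x using PiTensorProduct.induction_on with
  | smul_tprod r g =>
    induction y using PiTensorProduct.induction_on with
    | smul_tprod s f =>
      induction z using PiTensorProduct.induction_on with
      | smul_tprod t e => simp [tensorComp_tprod, LinearMap.comp_assoc]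
      | add z z' hz hz' => simp only [map_add, hz, hz']
    | add y y' hy hy' => simp only [map_add, LinearMap.add_apply, hy, hy']
  | add x x' hx hx' => simp only [map_add, LinearMap.add_apply, hx, hx']

lemma tensorComp_id (x : ⨂[K] _ : Fin n, (U →ₗ[K] V)) :
    tensorComp x (PiTensorProduct.tprod K (fun _ => (LinearMap.id : U →ₗ[K] U))) = x := by
  induction x using PiTensorProduct.induction_on with
  | smul_tprod r g => simp [tensorComp_tprod]
  | add x x' hx hx' => simp only [map_add, LinearMap.add_apply, hx, hx']

lemma id_tensorComp (x : ⨂[K] _ : Fin n, (U →ₗ[K] V)) :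
    tensorComp (PiTensorProduct.tprod K (fun _ => (LinearMap.id : V →ₗ[K] V))) x = x := by
  induction x using PiTensorProduct.induction_on with
  | smul_tprod r g => simp [tensorComp_tprod]
  | add x x' hx hx' => simp only [map_add, hx, hx']

/-- The canonical map `Hom(V, W)^{⊗ n} → Hom(V^{⊗ n}, W^{⊗ n})` turns `tensorComp` into
composition. -/
lemma piTensorHomMap_tensorComp (x : ⨂[K] _ : Fin n, (V →ₗ[K] W))
    (y : ⨂[K] _ : Fin n, (U →ₗ[K] V)) :
    PiTensorProduct.piTensorHomMap (tensorComp x y) =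
      PiTensorProduct.piTensorHomMap x ∘ₗ PiTensorProduct.piTensorHomMap y := by
  induction x using PiTensorProduct.induction_on with
  | smul_tprod r g =>
    induction y using PiTensorProduct.induction_on with
    | smul_tprod s f =>
      refine PiTensorProduct.ext (MultilinearMap.ext fun v => ?_)
      simp [tensorComp_tprod, smul_comm r s]
    | add y y' hy hy' => simp only [map_add, hy, hy', LinearMap.comp_add]
  | add x x' hx hx' => simp only [map_add, LinearMap.add_apply, hx, hx', LinearMap.add_comp]

lemma piTensorHomMap_tensorRep (σ : Equiv.Perm (Fin n)) (x : ⨂[K] _ : Fin n, (V →ₗ[K] W)) :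
    PiTensorProduct.piTensorHomMap (tensorRep K n _ σ x) ∘ₗ tensorRep K n V σ =
      tensorRep K n W σ ∘ₗ PiTensorProduct.piTensorHomMap x := by
  induction x using PiTensorProduct.induction_on with
  | smul_tprod r g =>
    refine PiTensorProduct.ext (MultilinearMap.ext fun v => ?_)
    simp
  | add x x' hx hx' => simp only [map_add, hx, hx', LinearMap.comp_add, LinearMap.add_comp]

end

/-- The category `Γⁿ V`: its objects are the finite-dimensional vector spaces. -/
structure GammaCat (K : Type u) [Field K] (n : ℕ) where
  /-- the underlying vector space -/
  space : FGModuleCat.{u} K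

/-- Morphisms from `V` to `W` in `Γⁿ V` are the elements of `Γⁿ(Hom(V, W))`. -/
instance : Category (GammaCat K n) where
  Hom V W := dividedPower K n (V.space →ₗ[K] W.space)
  id V := ⟨PiTensorProduct.tprod K (fun _ => LinearMap.id), fun σ => by simp⟩
  comp {U V W} f g := ⟨tensorComp g.1 f.1, fun σ => by
    rw [← tensorComp_tensorRep, g.2 σ, f.2 σ]⟩
  id_comp f := Subtype.ext (tensorComp_id f.1)
  comp_id f := Subtype.ext (id_tensorComp f.1)
  assoc f g h := Subtype.ext (tensorComp_assoc h.1 g.1 f.1)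

instance : Preadditive (GammaCat K n) where
  homGroup V W := inferInstanceAs (AddCommGroup (dividedPower K n (V.space →ₗ[K] W.space)))
  add_comp _ _ _ f f' g := Subtype.ext (map_add (tensorComp g.1) f.1 f'.1)
  comp_add _ _ _ f g g' := Subtype.ext (LinearMap.congr_fun (map_add tensorComp g.1 g'.1) f.1)

instance : Linear K (GammaCat K n) where
  homModule V W := inferInstanceAs (Module K (dividedPower K n (V.space →ₗ[K] W.space)))
  smul_comp _ _ _ r f g := Subtype.ext (map_smul (tensorComp g.1) r f.1)
  comp_smul _ _ _ f r g := Subtype.ext (LinearMap.congr_fun (map_smul tensorComp r g.1) f.1)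

variable (K n)

/-- The functor `V ↦ V^{⊗ n}` from `Γⁿ V` to finite-dimensional `𝔖_n`-modules. -/
def tensorFunctor : GammaCat K n ⥤ FDRep K (Equiv.Perm (Fin n)) where
  obj V := FDRep.of (tensorRep K n V.space)
  map {V W} f :=
    { hom := FGModuleCat.ofHom (PiTensorProduct.piTensorHomMap f.1)
      comm := fun σ => by
        ext1
        have h := piTensorHomMap_tensorRep σ f.1
        rw [f.2 σ] at h
        exact h }
  map_id V := by
    ext1
    ext1
    exact (PiTensorProduct.piTensorHomMap_tprod_eq_map _).trans PiTensorProduct.map_id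
  map_comp f g := by
    ext1
    ext1
    exact piTensorHomMap_tensorComp g.1 f.1

instance : (tensorFunctor K n).Additive where
  map_add {V W f g} := by
    ext1
    ext1
    exact map_add PiTensorProduct.piTensorHomMap f.1 g.1

instance : (tensorFunctor K n).Linear K where
  map_smul {V W} f r := by
    ext1
    ext1
    exact map_smul PiTensorProduct.piTensorHomMap r f.1

/-- The category `P_n` of homogeneous strict polynomial functors of degree `n`:
`K`-linear functors from `Γⁿ V` to finite-dimensional vector spaces. -/
abbrev StrictPolyFunctor := (isLinear K (GammaCat K n)).FullSubcategory

/-- The category `C_n` of coherent functors on finite-dimensional `𝔖_n`-modules. -/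
abbrev Coh := CoherentFunctor K (Equiv.Perm (Fin n))

/-- The functor `j^* : C_n ⥤ P_n`, `j^*(f)(V) = f(V^{⊗ n})`. -/
def jStar : Coh K n ⥤ StrictPolyFunctor K n :=
  (isLinear K (GammaCat K n)).lift
    ((isCoherent K (Equiv.Perm (Fin n))).ι ⋙
      (Functor.whiskeringLeft _ _ _).obj (tensorFunctor K n))
    (fun f => by
      obtain ⟨h₁, h₂⟩ := f.property.1
      exact ⟨inferInstanceAs (tensorFunctor K n ⋙ f.obj).Additive,
        inferInstanceAs ((tensorFunctor K n ⋙ f.obj).Linear K)⟩)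

end Gamma

/-! ## Young permutation modules -/

section Young

variable (K : Type u) [Field K] {n : ℕ}

/-- The composition of `n` whose blocks are the parts of the partition in decreasing order. -/
def partitionComposition (lam : n.Partition) : Composition n where
  blocks := lam.parts.sort (· ≥ ·)
  blocks_pos h := lam.parts_pos ((Multiset.mem_sort _).1 h)
  blocks_sum := by
    rw [← Multiset.sum_coe, Multiset.sort_eq, lam.parts_sum]

/-- The Young subgroup `𝔖_λ`: the permutations that map each of the consecutive blocks of lengths
`n₁ ≥ n₂ ≥ ⋯ ≥ n_k` to itself. -/
def youngSubgroup (lam : n.Partition) : Subgroup (Equiv.Perm (Fin n)) where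
  carrier := {σ | ∀ i, (partitionComposition lam).index (σ i) = (partitionComposition lam).index i}
  one_mem' _ := rfl
  mul_mem' {σ τ} hσ hτ i := (hσ (τ i)).trans (hτ i)
  inv_mem' {σ} hσ i := by
    simpa using (hσ (σ⁻¹ i)).symm

/-- The Young permutation module `K[𝔖_n/𝔖_λ]`. -/
def youngModule (lam : n.Partition) : FDRep K (Equiv.Perm (Fin n)) :=
  FDRep.of (Representation.ofMulAction K (Equiv.Perm (Fin n))
    (Equiv.Perm (Fin n) ⧸ youngSubgroup lam))

variable (n)

/-- The coherent functors that vanish on all Young permutation modules. -/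
def vanishesOnYoung : ObjectProperty (Coh K n) :=
  fun f => ∀ lam : n.Partition, IsZero (f.obj.obj (youngModule K lam))

/-- The full subcategory `C_n^Y` of `C_n`. -/
abbrev CohYoung := (vanishesOnYoung K n).FullSubcategory

end Young

end CoherentPoly

end

/-!
The proof rests on three ideas.

*Coherent functors form an abelian category.* A coherent functor `f` is the same as a linear
functor with a generator `x ∈ f(M)` (every element of every `f(X)` is `f(φ)x` for some
`φ : M ⟶ X`) and a map `α : M ⟶ N` such that `f(φ)x = 0` exactly when `φ` factors through `α`
(`IsPresentation`, `isCoherent_iff`). With pushouts and biproducts of modules such a presentation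
passes to pointwise kernels, cokernels and biproducts. Linear functors are closed under pointwise
subobjects and quotients, and the functors killed by an exact functor form an abelian
subcategory.

*The tensor powers sit in the middle.* The functor `T : V ↦ V^{⊗ n}` is fully faithful. A basis of
`V` gives a basis of `V^{⊗ n}` that is permuted by the symmetric group, and the stabilizer of a
basis vector is conjugate to the Young subgroup of the multiset of its multiplicities. Hence the
identity of `V^{⊗ n}` is a sum of maps through Young permutation modules
(`isCoveredBy_youngModule`), and each Young permutation module is a retract of `T(Kⁿ)`
(`exists_retract_standardSpace`). This identifies the kernel of `j^*`, and shows that `Kⁿ`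
generates `Γⁿ V`: each strict polynomial functor is a cokernel of a map between finite sums of
`Hom(Kⁿ, -)` and a kernel of a map between finite products of the dual functors
`D Hom(-, Kⁿ)`.

*Adjoints are determined on these objects.* By the Yoneda lemma, `j_!` is defined on
`Hom(U, -)` with value `Hom(T U, -)`, hence everywhere, because the class of objects on which a
partial left adjoint is defined is closed under colimits. The unit is invertible on `Hom(U, -)`
because `T` is fully faithful, and then everywhere by right exactness. Dually `j_*` sends
`D Hom(-, U)` to `D Hom(-, T U)`. The latter functor is coherent (`isCoherent_dualHomFunctor`): by
the trace pairing, `D Hom_G(X, M)` is the quotient of `Hom_K(M, X)` by the maps `w - g⁻¹ w g`, and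
`Hom_K(M, X)` is `Hom_G(P, X)` for the free module `P` on `M`. Exactness of `j^*` follows from the
two adjoints, and `i^*`, `i^!` are the cokernel of `j_! j^* f ⟶ f` and the kernel of
`f ⟶ j_* j^* f` (`nonempty_recollement`).
-/

noncomputable section

namespace CoherentPoly

open scoped ZeroObject

/-! ### Linear functors form an abelian category -/

section LinearFunctors

variable {K : Type u} [Field K] {D : Type*} [Category D] [Preadditive D] [Linear K D]

instance : (isLinear K D).IsClosedUnderSubobjects where
  prop_of_mono {F G} m _ hG := by
    obtain ⟨_, _⟩ := hG
    exact ⟨⟨fun {X Y f g} => by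
        rw [← cancel_mono (m.app Y)]
        simp [Preadditive.add_comp, Functor.map_add]⟩,
      ⟨fun {X Y} f r => by
        rw [← cancel_mono (m.app Y)]
        simp [Functor.map_smul]⟩⟩

instance : (isLinear K D).IsClosedUnderQuotients where
  prop_of_epi {F G} e _ hF := by
    obtain ⟨_, _⟩ := hF
    exact ⟨⟨fun {X Y f g} => by
        rw [← cancel_epi (e.app X)]
        simp only [← NatTrans.naturality, Preadditive.comp_add, Functor.map_add,
          Preadditive.add_comp]⟩,
      ⟨fun {X Y} f r => by
        rw [← cancel_epi (e.app X)]
        simp only [← NatTrans.naturality, Linear.comp_smul, Functor.map_smul,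
          Linear.smul_comp]⟩⟩

instance : (isLinear K D).ContainsZero where
  exists_zero := ⟨0, isZero_zero _, ⟨⟨fun {X Y f g} => by
      apply (((evaluation _ _).obj X).map_isZero (isZero_zero _)).eq_of_src⟩,
    ⟨fun {X Y} f r => by
      apply (((evaluation _ _).obj X).map_isZero (isZero_zero _)).eq_of_src⟩⟩⟩

instance : (isLinear K D).IsClosedUnderFiniteProducts where
  isClosedUnderLimitsOfShape J _ := ⟨by
    rintro F ⟨p⟩
    have h := fun j => p.prop_diag_obj j
    have hom_ext {X Y : D} {a b : F.obj X ⟶ F.obj Y}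
        (hab : ∀ j, a ≫ (p.π.app j).app Y = b ≫ (p.π.app j).app Y) : a = b :=
      (isLimitOfPreserves ((evaluation _ _).obj Y) p.isLimit).hom_ext hab
    refine ⟨⟨fun {X Y f g} => hom_ext fun j => ?_⟩, ⟨fun {X Y} f r => hom_ext fun j => ?_⟩⟩
    · have := (h j).1
      simp [Functor.map_add]
    · have := (h j).2
      simp [Functor.map_smul]⟩

variable (K D) in
theorem isAbelianCategory_linear : IsAbelianCategory (isLinear K D).FullSubcategory :=
  ⟨inferInstance, rfl⟩

end LinearFunctors
/-! ### Evaluation of functors at elements -/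

section Evaluation

variable {K : Type u} [Field K] {D : Type*} [Category D]

lemma map_id_apply (F : D ⥤ FGModuleCat.{u} K) {X : D}
    (x : F.obj X) : (F.map (𝟙 X)).hom.hom x = x := by rw [F.map_id]; rfl

lemma map_comp_apply (F : D ⥤ FGModuleCat.{u} K) {X Y Z : D} (f : X ⟶ Y) (g : Y ⟶ Z)
    (x : F.obj X) : (F.map (f ≫ g)).hom.hom x = (F.map g).hom.hom ((F.map f).hom.hom x) := by
  rw [F.map_comp]; rfl

lemma naturality_apply {F F' : D ⥤ FGModuleCat.{u} K} (η : F ⟶ F') {X Y : D} (f : X ⟶ Y)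
    (x : F.obj X) :
    (η.app Y).hom.hom ((F.map f).hom.hom x) = (F'.map f).hom.hom ((η.app X).hom.hom x) :=
  congrArg (fun a => a.hom.hom x) (η.naturality f)

lemma natTrans_ext_apply {F F' : D ⥤ FGModuleCat.{u} K} {η θ : F ⟶ F'}
    (h : ∀ (X : D) (x : F.obj X), (η.app X).hom.hom x = (θ.app X).hom.hom x) : η = θ := by
  ext X x
  exact h X x

variable [Preadditive D] [Linear K D]

lemma map_add_apply {F : D ⥤ FGModuleCat.{u} K} (hF : isLinear K D F) {X Y : D} (f g : X ⟶ Y)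
    (x : F.obj X) : (F.map (f + g)).hom.hom x = (F.map f).hom.hom x + (F.map g).hom.hom x := by
  have := hF.1
  rw [F.map_add]; rfl

lemma map_smul_apply {F : D ⥤ FGModuleCat.{u} K} (hF : isLinear K D F) {X Y : D} (r : K)
    (f : X ⟶ Y) (x : F.obj X) : (F.map (r • f)).hom.hom x = r • (F.map f).hom.hom x := by
  have := hF.2
  rw [F.map_smul]; rfl

lemma map_sum_apply {F : D ⥤ FGModuleCat.{u} K} (hF : isLinear K D F) {X Y : D} {ι : Type*}
    (s : Finset ι) (f : ι → (X ⟶ Y))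
    (x : F.obj X) : (F.map (∑ i ∈ s, f i)).hom.hom x = ∑ i ∈ s, (F.map (f i)).hom.hom x := by
  let L : (X ⟶ Y) →+ F.obj Y :=
    { toFun := fun f => (F.map f).hom.hom x
      map_zero' := by
        have := hF.1
        rw [F.map_zero]; rfl
      map_add' := fun f g => map_add_apply hF f g x }
  exact map_sum L f s

end Evaluation

/-! ### Representable functors, their duals, and the Yoneda lemma -/

section Yoneda

variable {K : Type u} [Field K] {D : Type*} [Category.{u} D] [Preadditive D] [Linear K D]
  [∀ X Y : D, Module.Finite K (X ⟶ Y)]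

variable (K) in
/-- The functor `Hom(U, -)` on a linear category with finite-dimensional morphism spaces. -/
def homFunctor (U : D) : D ⥤ FGModuleCat.{u} K :=
  (ModuleCat.isFG K).lift ((linearCoyoneda K D).obj (Opposite.op U))
    (fun X => inferInstanceAs (Module.Finite K (U ⟶ X)))

lemma isLinear_homFunctor (U : D) : isLinear K D (homFunctor K U) :=
  ⟨⟨by
      intro X Y f g; ext x; exact Preadditive.comp_add _ _ _ x f g⟩,
    ⟨by intro X Y f r; ext x; exact Linear.comp_smul _ _ _ x r f⟩⟩

variable (K) in
/-- The functor `X ↦ Hom(X, U)^*`. -/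
def dualHomFunctor (U : D) : D ⥤ FGModuleCat.{u} K where
  obj X := FGModuleCat.of K (Module.Dual K (X ⟶ U))
  map f := FGModuleCat.ofHom (Linear.leftComp K U f).dualMap
  map_id X := by
    ext x φ
    exact congrArg x (Category.id_comp φ)
  map_comp f g := by
    ext x φ
    exact congrArg x (Category.assoc f g φ)

variable (K) in
/-- An element of `dualHomFunctor K U` at `X`, as a functional on `Hom(X, U)`. -/
def dualHomPairing (U X : D) : (dualHomFunctor K U).obj X ≃ₗ[K] Module.Dual K (X ⟶ U) :=
  LinearEquiv.refl K _

lemma isLinear_dualHomFunctor (U : D) : isLinear K D (dualHomFunctor K U) :=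
  ⟨⟨by
      intro X Y f g
      ext x
      exact LinearMap.ext fun φ => (congrArg (dualHomPairing K U X x)
        (Preadditive.add_comp _ _ _ f g φ)).trans (map_add _ _ _)⟩,
    ⟨by
      intro X Y f r
      ext x
      exact LinearMap.ext fun φ => (congrArg (dualHomPairing K U X x)
        (Linear.smul_comp _ _ _ r f φ)).trans (map_smul _ _ _)⟩⟩

/-- The Yoneda lemma for linear functors: `Nat(Hom(U, -), F) ≃ F(U)`. -/
def homFunctorEquiv (U : D) {F : D ⥤ FGModuleCat.{u} K} (hF : isLinear K D F) :
    (homFunctor K U ⟶ F) ≃ F.obj U where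
  toFun η := (η.app U).hom.hom (𝟙 U)
  invFun x :=
    { app X := ObjectProperty.homMk (ModuleCat.ofHom
        { toFun φ := (F.map φ).hom.hom x
          map_add' φ ψ := map_add_apply hF φ ψ x
          map_smul' r φ := map_smul_apply hF r φ x })
      naturality X Y f := by
        ext φ
        exact map_comp_apply F φ f x }
  left_inv η := natTrans_ext_apply fun X φ =>
    (naturality_apply η φ (𝟙 U)).symm.trans (congrArg _ (Category.id_comp φ))
  right_inv x := map_id_apply F x

/-- The dual Yoneda lemma for linear functors: `Nat(F, Hom(-, U)^*) ≃ F(U)^*`. -/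
def dualHomFunctorEquiv (U : D) {F : D ⥤ FGModuleCat.{u} K} (hF : isLinear K D F) :
    (F ⟶ dualHomFunctor K U) ≃ Module.Dual K (F.obj U) where
  toFun η :=
    { toFun y := dualHomPairing K U U ((η.app U).hom.hom y) (𝟙 U)
      map_add' y z := by simp only [map_add]; rfl
      map_smul' r y := by simp only [map_smul]; rfl }
  invFun l :=
    { app X := ObjectProperty.homMk (ModuleCat.ofHom
        { toFun y :=
            { toFun φ := l ((F.map φ).hom.hom y)
              map_add' φ ψ := by rw [map_add_apply hF, map_add]
              map_smul' r φ := by rw [map_smul_apply hF, map_smul]; rfl }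
          map_add' y z := LinearMap.ext fun φ => by
            simp only [map_add]; rfl
          map_smul' r y := LinearMap.ext fun φ => by
            simp only [map_smul]; rfl })
      naturality X Y f := by
        ext y
        exact LinearMap.ext fun φ => congrArg l (map_comp_apply F f φ y).symm }
  left_inv η := natTrans_ext_apply fun X y => LinearMap.ext fun φ => by
    refine (congrArg (fun a => dualHomPairing K U U a (𝟙 U)) (naturality_apply η φ y)).trans ?_
    exact congrArg (dualHomPairing K U X ((η.app X).hom.hom y)) (Category.comp_id φ)
  right_inv l := LinearMap.ext fun y => congrArg l (map_id_apply F y)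

end Yoneda

/-! ### Pointwise exactness in functor categories -/

section PointwiseExact

variable {K : Type u} [Field K] {D : Type*} [Category D]
  {F F' : D ⥤ FGModuleCat.{u} K} {η : F ⟶ F'}

/-- Evaluation at `X`, with values in all vector spaces. -/
def evalModule (X : D) : (D ⥤ FGModuleCat.{u} K) ⥤ ModuleCat.{u} K :=
  (evaluation D (FGModuleCat.{u} K)).obj X ⋙ forget₂ (FGModuleCat.{u} K) (ModuleCat.{u} K)

instance (X : D) : PreservesFiniteLimits (evalModule (K := K) X) :=
  comp_preservesFiniteLimits _ _

instance (X : D) : PreservesFiniteColimits (evalModule (K := K) X) :=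
  comp_preservesFiniteColimits _ _

instance (X : D) : (evalModule (K := K) X).Additive where
  map_add := rfl

lemma mono_iff_injective_app : Mono η ↔ ∀ X, Function.Injective (η.app X).hom.hom := by
  constructor
  · intro _ X
    exact (ModuleCat.mono_iff_injective ((evalModule X).map η)).1 inferInstance
  · intro h
    exact ⟨fun a b hab => natTrans_ext_apply fun X x => h X
      (congrArg (fun c => (c.app X).hom.hom x) hab)⟩

lemma epi_iff_surjective_app : Epi η ↔ ∀ X, Function.Surjective (η.app X).hom.hom := by
  constructor
  · intro _ X
    exact (ModuleCat.epi_iff_surjective ((evalModule X).map η)).1 inferInstance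
  · intro h
    refine ⟨fun a b hab => natTrans_ext_apply fun X x => ?_⟩
    obtain ⟨y, rfl⟩ := h X x
    exact congrArg (fun c => (c.app X).hom.hom y) hab

lemma exact_app_of_isLimit {k : KernelFork η} (hk : IsLimit k) (X : D) :
    Function.Exact (k.ι.app X).hom.hom (η.app X).hom.hom :=
  (ShortComplex.ShortExact.moduleCat_exact_iff_function_exact _).1
    ((ShortComplex.exact_of_f_is_kernel (ShortComplex.mk k.ι η k.condition)
      (IsLimit.ofIsoLimit hk (Fork.ext (Iso.refl _)))).map (evalModule X))

lemma exact_app_of_isColimit {k : CokernelCofork η} (hk : IsColimit k) (X : D) :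
    Function.Exact (η.app X).hom.hom (k.π.app X).hom.hom :=
  (ShortComplex.ShortExact.moduleCat_exact_iff_function_exact _).1
    ((ShortComplex.exact_of_g_is_cokernel (ShortComplex.mk η k.π k.condition)
      (IsColimit.ofIsoColimit hk (Cofork.ext (Iso.refl _)))).map (evalModule X))

end PointwiseExact

/-! ### Presentations by elements -/

section Presentations

variable {K : Type u} [Field K] {D : Type*} [Category D]

/-- The element `x` of `F(M)` generates `F`, and its relations are generated by `α : M ⟶ N`.
Equivalently `h_N ⟶ h_M ⟶ F ⟶ 0` is exact, the maps being given by `α` and `x`. -/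
structure IsPresentation (F : D ⥤ FGModuleCat.{u} K) {M N : D} (α : M ⟶ N) (x : F.obj M) :
    Prop where
  generates (X : D) (y : F.obj X) : ∃ φ : M ⟶ X, (F.map φ).hom.hom x = y
  map_eq_zero_iff {X : D} (φ : M ⟶ X) : (F.map φ).hom.hom x = 0 ↔ ∃ ψ : N ⟶ X, α ≫ ψ = φ

variable {F F' : D ⥤ FGModuleCat.{u} K} {M N M' N' : D} {α : M ⟶ N} {α' : M' ⟶ N'}
  {x : F.obj M} {x' : F'.obj M'}

/-- The generator of the kernel is the image of `x` along a pushout `P` of `α'`, and its relations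
are given by the pushout of `α` to `P`. -/
lemma IsPresentation.kernel [HasPushouts D] (h : IsPresentation F α x)
    (h' : IsPresentation F' α' x') {η : F ⟶ F'} {k : KernelFork η} (hk : IsLimit k) :
    ∃ (P Q : D) (γ : P ⟶ Q) (z : k.pt.obj P), IsPresentation k.pt γ z := by
  have inj := mono_iff_injective_app.1 (Fork.IsLimit.mono hk : Mono k.ι)
  have ex := exact_app_of_isLimit hk
  obtain ⟨β, hβ⟩ := h'.generates M ((η.app M).hom.hom x)
  -- `F(φ)x` lies in the kernel if and only if `φ` factors through the pushout of `α'` along `β`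
  have key {X : D} (φ : M ⟶ X) : (η.app X).hom.hom ((F.map φ).hom.hom x) = 0 ↔
      ∃ χ, pushout.inl β α' ≫ χ = φ := by
    rw [naturality_apply, ← hβ, ← map_comp_apply, h'.map_eq_zero_iff]
    constructor
    · rintro ⟨ψ, hψ⟩
      exact ⟨pushout.desc φ ψ hψ.symm, pushout.inl_desc _ _ _⟩
    · rintro ⟨χ, rfl⟩
      exact ⟨pushout.inr β α' ≫ χ, by
        rw [← Category.assoc, ← pushout.condition, Category.assoc]⟩
  obtain ⟨z, hz⟩ := (ex _ _).1 ((key (pushout.inl β α')).2 ⟨𝟙 _, by simp⟩)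
  have hz' {X : D} (χ : pushout β α' ⟶ X) : (k.ι.app X).hom.hom ((k.pt.map χ).hom.hom z) =
      (F.map (pushout.inl β α' ≫ χ)).hom.hom x := by
    rw [naturality_apply, hz, map_comp_apply]
  refine ⟨_, _, pushout.inl (pushout.inl β α') α, z, ⟨fun X y => ?_, fun {X} χ => ?_⟩⟩
  · obtain ⟨φ, hφ⟩ := h.generates X ((k.ι.app X).hom.hom y)
    obtain ⟨χ, hχ⟩ := (key φ).1 (by rw [hφ]; exact (ex X _).2 ⟨y, rfl⟩)
    exact ⟨χ, inj X (by rw [hz', hχ, hφ])⟩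
  · rw [← (inj X).eq_iff, hz', map_zero, h.map_eq_zero_iff]
    constructor
    · rintro ⟨ψ, hψ⟩
      exact ⟨pushout.desc χ ψ hψ.symm, pushout.inl_desc _ _ _⟩
    · rintro ⟨ψ, rfl⟩
      exact ⟨pushout.inr (pushout.inl β α') α ≫ ψ, by
        rw [← Category.assoc, ← pushout.condition, Category.assoc]⟩

variable [Preadditive D]

section

variable [HasBinaryBiproducts D]

lemma IsPresentation.biproduct (h : IsPresentation F α x) (h' : IsPresentation F' α' x')
    (b : BinaryBicone F F') (hb : b.IsBilimit) :
    ∃ (P Q : D) (γ : P ⟶ Q) (z : b.pt.obj P), IsPresentation b.pt γ z := by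
  let z : b.pt.obj (M ⊞ M') := (b.pt.map biprod.inl).hom.hom ((b.inl.app M).hom.hom x) +
    (b.pt.map biprod.inr).hom.hom ((b.inr.app M').hom.hom x')
  have hz {X : D} (φ : M ⊞ M' ⟶ X) : (b.pt.map φ).hom.hom z =
      (b.inl.app X).hom.hom ((F.map (biprod.inl ≫ φ)).hom.hom x) +
        (b.inr.app X).hom.hom ((F'.map (biprod.inr ≫ φ)).hom.hom x') := by
    simp only [z, map_add, naturality_apply, map_comp_apply]
  have h₁ (X : D) (y : F.obj X) : (b.fst.app X).hom.hom ((b.inl.app X).hom.hom y) = y :=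
    congrArg (fun a => (a.app X).hom.hom y) b.inl_fst
  have h₂ (X : D) (y : F'.obj X) : (b.snd.app X).hom.hom ((b.inr.app X).hom.hom y) = y :=
    congrArg (fun a => (a.app X).hom.hom y) b.inr_snd
  have h₃ (X : D) (y : F.obj X) : (b.snd.app X).hom.hom ((b.inl.app X).hom.hom y) = 0 :=
    congrArg (fun a => (a.app X).hom.hom y) b.inl_snd
  have h₄ (X : D) (y : F'.obj X) : (b.fst.app X).hom.hom ((b.inr.app X).hom.hom y) = 0 :=
    congrArg (fun a => (a.app X).hom.hom y) b.inr_fst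
  have h₅ (X : D) (y : b.pt.obj X) : (b.inl.app X).hom.hom ((b.fst.app X).hom.hom y) +
      (b.inr.app X).hom.hom ((b.snd.app X).hom.hom y) = y :=
    congrArg (fun a => (a.app X).hom.hom y) (IsBilimit.binary_total hb)
  refine ⟨_, _, biprod.map α α', z, ⟨fun X y => ?_, fun {X} φ => ?_⟩⟩
  · obtain ⟨φ, hφ⟩ := h.generates X ((b.fst.app X).hom.hom y)
    obtain ⟨φ', hφ'⟩ := h'.generates X ((b.snd.app X).hom.hom y)
    exact ⟨biprod.desc φ φ', by rw [hz, biprod.inl_desc, biprod.inr_desc, hφ, hφ', h₅]⟩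
  · rw [hz]
    constructor
    · intro h0
      have h0₁ := congrArg (b.fst.app X).hom.hom h0
      have h0₂ := congrArg (b.snd.app X).hom.hom h0
      rw [map_add, h₁, h₄, add_zero, map_zero, h.map_eq_zero_iff] at h0₁
      rw [map_add, h₂, h₃, zero_add, map_zero, h'.map_eq_zero_iff] at h0₂
      obtain ⟨ψ, hψ⟩ := h0₁
      obtain ⟨ψ', hψ'⟩ := h0₂
      exact ⟨biprod.desc ψ ψ', biprod.hom_ext' _ _ (by simp [hψ]) (by simp [hψ'])⟩
    · rintro ⟨ψ, rfl⟩
      rw [(h.map_eq_zero_iff _).2 ⟨biprod.inl ≫ ψ, by simp⟩,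
        (h'.map_eq_zero_iff _).2 ⟨biprod.inr ≫ ψ, by simp⟩, map_zero, map_zero, add_zero]

end

variable [Linear K D]

lemma map_sub_apply (hF : isLinear K D F) {X Y : D} (f g : X ⟶ Y)
    (x : F.obj X) : (F.map (f - g)).hom.hom x = (F.map f).hom.hom x - (F.map g).hom.hom x := by
  have := hF.1
  rw [F.map_sub]; rfl

variable [HasBinaryBiproducts D]

/-- The cokernel has the generator of the target; the generator of the source adds one relation. -/
lemma IsPresentation.cokernel (hF' : isLinear K D F') (h : IsPresentation F α x)
    (h' : IsPresentation F' α' x') {η : F ⟶ F'} {k : CokernelCofork η} (hk : IsColimit k) :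
    ∃ (P Q : D) (γ : P ⟶ Q) (z : k.pt.obj P), IsPresentation k.pt γ z := by
  have surj := epi_iff_surjective_app.1 (Cofork.IsColimit.epi hk : Epi k.π)
  have ex := exact_app_of_isColimit hk
  obtain ⟨β, hβ⟩ := h'.generates M ((η.app M).hom.hom x)
  have hβ' {X : D} (χ : M ⟶ X) : (η.app X).hom.hom ((F.map χ).hom.hom x) =
      (F'.map (β ≫ χ)).hom.hom x' := by
    rw [naturality_apply, ← hβ, map_comp_apply]
  refine ⟨_, _, biprod.lift α' β, (k.π.app M').hom.hom x', ⟨fun X y => ?_, fun {X} φ => ?_⟩⟩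
  · obtain ⟨y, rfl⟩ := surj X y
    obtain ⟨φ, rfl⟩ := h'.generates X y
    exact ⟨φ, (naturality_apply k.π φ x').symm⟩
  · rw [← naturality_apply]
    refine (ex X _).trans ⟨?_, ?_⟩
    · rintro ⟨y, hy⟩
      obtain ⟨χ, rfl⟩ := h.generates X y
      obtain ⟨ψ, hψ⟩ := (h'.map_eq_zero_iff (φ - β ≫ χ)).1 (by
        rw [map_sub_apply hF', ← hβ', hy, sub_self])
      exact ⟨biprod.desc ψ χ, by simp [hψ]⟩
    · rintro ⟨ψ, rfl⟩
      refine ⟨(F.map (biprod.inr ≫ ψ)).hom.hom x, ?_⟩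
      have : biprod.lift α' β ≫ ψ = α' ≫ biprod.inl ≫ ψ + β ≫ biprod.inr ≫ ψ := by
        rw [biprod.lift_eq]; simp
      rw [hβ', this, map_add_apply hF', (h'.map_eq_zero_iff (α' ≫ biprod.inl ≫ ψ)).2 ⟨_, rfl⟩,
        zero_add]

end Presentations

/-! ### Coherent functors form an abelian category -/

section CoherentAbelian

variable {K : Type u} [Field K] {G : Type} [Group G]

lemma isLinear_hFunctor (M : FDRep K G) : isLinear K (FDRep K G) (hFunctor K G M) :=
  isLinear_homFunctor M

/-- By the Yoneda lemma, the maps in the definition of coherence are given by `α` and `x`. -/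
lemma isCoherent_iff (F : FDRep K G ⥤ FGModuleCat.{u} K) :
    isCoherent K G F ↔ isLinear K (FDRep K G) F ∧
      ∃ (M N : FDRep K G) (α : M ⟶ N) (x : F.obj M), IsPresentation F α x := by
  refine and_congr_right fun hF => ⟨?_, ?_⟩
  · rintro ⟨M, N, a, π, h⟩
    refine ⟨M, N, homFunctorEquiv N (isLinear_hFunctor M) a, homFunctorEquiv M hF π,
      ⟨fun X y => ?_, fun {X} φ => ?_⟩⟩
    · obtain ⟨φ, rfl⟩ := (h X).2 y
      exact ⟨φ, congrArg (fun θ => (θ.app X).hom.hom φ)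
        ((homFunctorEquiv M hF).symm_apply_apply π)⟩
    · have h₁ : (F.map φ).hom.hom (homFunctorEquiv M hF π) = (π.app X).hom.hom φ :=
        congrArg (fun θ => (θ.app X).hom.hom φ) ((homFunctorEquiv M hF).symm_apply_apply π)
      rw [h₁]
      refine ((h X).1 φ).trans (exists_congr fun ψ => ?_)
      have h₂ : (a.app X).hom.hom ψ = homFunctorEquiv N (isLinear_hFunctor M) a ≫ ψ :=
        (congrArg (fun θ => (θ.app X).hom.hom ψ)
          ((homFunctorEquiv N (isLinear_hFunctor M)).symm_apply_apply a)).symm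
      rw [h₂]; rfl
  · rintro ⟨M, N, α, x, h⟩
    refine ⟨M, N, (homFunctorEquiv N (isLinear_hFunctor M)).symm α,
      (homFunctorEquiv M hF).symm x, fun X => ⟨fun φ => ?_, fun y => ?_⟩⟩
    · exact h.map_eq_zero_iff φ
    · exact h.generates X y

instance : (isCoherent K G).IsClosedUnderKernels where
  kernels_le := by
    rintro _ ⟨η, k, hk, ⟨hF, hF'⟩⟩
    rw [isCoherent_iff] at hF hF' ⊢
    obtain ⟨hF, M, N, α, x, h⟩ := hF
    obtain ⟨hF', M', N', α', x', h'⟩ := hF'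
    exact ⟨(isLinear K (FDRep K G)).prop_of_isLimit_kernelFork hk hF hF', h.kernel h' hk⟩

instance : (isCoherent K G).IsClosedUnderCokernels where
  cokernels_le := by
    rintro _ ⟨η, k, hk, ⟨hF, hF'⟩⟩
    rw [isCoherent_iff] at hF hF' ⊢
    obtain ⟨hF, M, N, α, x, h⟩ := hF
    obtain ⟨hF', M', N', α', x', h'⟩ := hF'
    exact ⟨(isLinear K (FDRep K G)).prop_of_isColimit_cokernelCofork hk hF hF',
      h.cokernel hF' h' hk⟩

lemma isCoherent_hFunctor (M : FDRep K G) : isCoherent K G (hFunctor K G M) := by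
  rw [isCoherent_iff]
  refine ⟨isLinear_hFunctor M, M, 0, 0, 𝟙 M, ⟨fun X y => ⟨y, Category.id_comp y⟩, fun {X} φ => ?_⟩⟩
  have h : ((hFunctor K G M).map φ).hom.hom (𝟙 M) = φ := Category.id_comp φ
  rw [h]
  exact ⟨fun h => ⟨0, by rw [zero_comp]; exact h.symm⟩, fun ⟨ψ, h⟩ => by
    rw [← h, zero_comp]; rfl⟩

instance : (isCoherent K G).ContainsZero where
  exists_zero := ⟨cokernel (𝟙 (hFunctor K G 0)), isZero_cokernel_of_epi _,
    (isCoherent K G).prop_cokernel _ (isCoherent_hFunctor 0) (isCoherent_hFunctor 0)⟩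

instance : (isCoherent K G).IsClosedUnderIsomorphisms where
  of_iso {F F'} e hF := by
    have hk : IsLimit (KernelFork.ofι (f := (0 : F ⟶ F)) e.inv (by simp)) :=
      IsLimit.ofIsoLimit (KernelFork.IsLimit.ofId (0 : F ⟶ F) rfl) (Fork.ext e)
    exact (isCoherent K G).prop_of_isLimit_kernelFork hk hF hF

instance : (isCoherent K G).IsClosedUnderBinaryProducts where
  limitsOfShape_le := by
    rintro E ⟨p⟩
    have hF := p.prop_diag_obj ⟨WalkingPair.left⟩
    have hF' := p.prop_diag_obj ⟨WalkingPair.right⟩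
    rw [isCoherent_iff] at hF hF' ⊢
    obtain ⟨hF, M, N, α, x, h⟩ := hF
    obtain ⟨hF', M', N', α', x', h'⟩ := hF'
    have hE := (IsLimit.postcomposeHomEquiv (diagramIsoPair p.diag) _).2 p.isLimit
    exact ⟨(isLinear K (FDRep K G)).prop_of_isLimit p.isLimit (by rintro ⟨_ | _⟩ <;> assumption),
      h.biproduct h' _ (binaryBiconeIsBilimitOfLimitConeOfIsLimit hE)⟩

instance : (isCoherent K G).IsClosedUnderFiniteProducts := .mk'

variable (K G) in
theorem isAbelianCategory_coherent : IsAbelianCategory (CoherentFunctor K G) :=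
  ⟨inferInstance, rfl⟩

end CoherentAbelian

/-! ### Objects with presentations and copresentations -/

section Resolutions

variable {C : Type*} [Category C] [Abelian C] (P : ObjectProperty C)

/-- If every object is a quotient of a finite sum of copies of `S`, then every object is a cokernel
of a map between such sums, and a property closed under finite colimits spreads from `S`. -/
lemma prop_of_coproduct_presentation [P.IsClosedUnderFiniteCoproducts]
    [P.IsClosedUnderColimitsOfShape WalkingParallelPair] {S : C} (hS : P S)
    (hgen : ∀ X : C, ∃ (d : ℕ) (e : (∐ fun _ : Fin d => S) ⟶ X), Epi e) (X : C) : P X := by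
  obtain ⟨d, e, he⟩ := hgen X
  obtain ⟨d', e', he'⟩ := hgen (kernel e)
  have hc := isCokernelEpiComp (Abelian.epiIsCokernelOfKernel _ (kernelIsKernel e)) e' rfl
  refine P.prop_of_isColimit hc ?_
  rintro (_ | _)
  · exact P.prop_of_isColimit (coproductIsCoproduct fun _ : Fin d' => S) fun _ => hS
  · exact P.prop_of_isColimit (coproductIsCoproduct fun _ : Fin d => S) fun _ => hS

/-- The dual of `prop_of_coproduct_presentation`. -/
lemma prop_of_product_copresentation [P.IsClosedUnderFiniteProducts]
    [P.IsClosedUnderLimitsOfShape WalkingParallelPair] {S : C} (hS : P S)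
    (hcogen : ∀ X : C, ∃ (d : ℕ) (e : X ⟶ ∏ᶜ fun _ : Fin d => S), Mono e) (X : C) : P X := by
  obtain ⟨d, e, he⟩ := hcogen X
  obtain ⟨d', e', he'⟩ := hcogen (cokernel e)
  have hc := isKernelCompMono (Abelian.monoIsKernelOfCokernel _ (cokernelIsCokernel e)) e' rfl
  refine P.prop_of_isLimit hc ?_
  rintro (_ | _)
  · exact P.prop_of_isLimit (productIsProduct fun _ : Fin d => S) fun _ => hS
  · exact P.prop_of_isLimit (productIsProduct fun _ : Fin d' => S) fun _ => hS

end Resolutions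

/-! ### Partial adjoints -/

section Adjoints

variable {A B : Type*} [Category A] [Category B] (j : A ⥤ B)

instance {J : Type*} [Category J] [HasColimitsOfShape J A] :
    j.leftAdjointObjIsDefined.IsClosedUnderColimitsOfShape J where
  colimitsOfShape_le := by
    rintro X ⟨p⟩
    exact Functor.leftAdjointObjIsDefined_of_isColimit p.isColimit p.prop_diag_obj

instance {J : Type*} [Category J] [HasLimitsOfShape J A] :
    j.rightAdjointObjIsDefined.IsClosedUnderLimitsOfShape J where
  limitsOfShape_le := by
    rintro X ⟨p⟩
    exact Functor.rightAdjointObjIsDefined_of_isLimit p.isLimit p.prop_diag_obj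

lemma isClosedUnderColimitsOfShape_isIso_app {L L' : A ⥤ B} (α : L ⟶ L') (J : Type*) [Category J]
    [PreservesColimitsOfShape J L] [PreservesColimitsOfShape J L'] :
    ObjectProperty.IsClosedUnderColimitsOfShape (fun X => IsIso (α.app X)) J where
  colimitsOfShape_le := by
    rintro X ⟨p⟩
    have : ∀ k, IsIso ((Functor.whiskerLeft p.diag α).app k) := p.prop_diag_obj
    have := NatIso.isIso_of_isIso_app (Functor.whiskerLeft p.diag α)
    exact isIso_app_coconePt_of_preservesColimit p.diag α _ p.isColimit

variable {j}

/-- A universal arrow from `X` to `j` exhibits a value of the left adjoint of `j` at `X`. -/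
lemma leftAdjointObjIsDefined_of_bijective {X : B} {Y : A} (u : X ⟶ j.obj Y)
    (hu : ∀ Z : A, Function.Bijective fun g : Y ⟶ Z => u ≫ j.map g) :
    j.leftAdjointObjIsDefined X :=
  Functor.CorepresentableBy.isCorepresentable (X := Y)
    { homEquiv {Z} := Equiv.ofBijective _ (hu Z)
      homEquiv_comp g f := by simp }

/-- A universal arrow from `j` to `X` exhibits a value of the right adjoint of `j` at `X`. -/
lemma rightAdjointObjIsDefined_of_bijective {X : B} {Y : A} (u : j.obj Y ⟶ X)
    (hu : ∀ Z : A, Function.Bijective fun g : Z ⟶ Y => j.map g ≫ u) :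
    j.rightAdjointObjIsDefined X :=
  Functor.RepresentableBy.isRepresentable (Y := Y)
    { homEquiv {Z} := Equiv.ofBijective _ (hu Z)
      homEquiv_comp g f := by simp }

/-- The unit at `X` is an isomorphism as soon as some universal arrow from `X` to `j` is one. -/
lemma isIso_unit_app_of_bijective {L : B ⥤ A} (adj : L ⊣ j) {X : B} {Y : A} (u : X ⟶ j.obj Y)
    [IsIso u] (hu : ∀ Z : A, Function.Bijective fun g : Y ⟶ Z => u ≫ j.map g) :
    IsIso (adj.unit.app X) := by
  obtain ⟨w, hw⟩ := (hu (L.obj X)).2 (adj.unit.app X)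
  obtain ⟨v, hv⟩ : ∃ v : L.obj X ⟶ Y, adj.unit.app X ≫ j.map v = u :=
    ⟨(adj.homEquiv X Y).symm u, (adj.homEquiv_unit _ _ _).symm.trans (Equiv.apply_symm_apply _ _)⟩
  dsimp only at hw
  have hwv : w ≫ v = 𝟙 Y := (hu Y).1 (by
    dsimp only
    rw [j.map_comp, ← Category.assoc, hw, hv, j.map_id, Category.comp_id])
  have hvw : v ≫ w = 𝟙 (L.obj X) := (adj.homEquiv X _).injective (by
    rw [adj.homEquiv_unit, adj.homEquiv_unit, j.map_comp, ← Category.assoc, hv, hw, j.map_id]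
    exact (Category.comp_id _).symm)
  have : IsIso w := ⟨v, hwv, hvw⟩
  rw [← hw]
  infer_instance

end Adjoints

/-! ### Recollements from an adjoint triple -/

section Recollement

variable {A B : Type*} [Category A] [Category B] [Abelian A] [Abelian B] {j : A ⥤ B}

/-- A functor between abelian categories with a left adjoint `l` and a right adjoint `r`, and with
invertible unit `Id ⟶ j l`, is the quotient functor of a recollement. The functors `i^*` and `i^!`
are the cokernel of the counit `l j ⟶ Id` and the kernel of the unit `Id ⟶ r j`. -/
theorem nonempty_recollement [j.Additive] (P : ObjectProperty A)
    (hP : ∀ X, P X ↔ IsZero (j.obj X)) {l r : B ⥤ A} (adjl : l ⊣ j) (adjr : j ⊣ r)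
    [IsIso adjl.unit] : Nonempty (Recollement P.ι j) := by
  have := adjl.isRightAdjoint
  have := adjr.isLeftAdjoint
  have : PreservesFiniteLimits j := inferInstance
  have : PreservesFiniteColimits j := inferInstance
  have : IsIso adjr.counit := (Adjunction.Triple.mk adjl adjr).isIso_unit_iff_isIso_counit.1 ‹_›
  have left : P.ι.IsRightAdjoint := by
    refine Functor.isRightAdjoint_of_leftAdjointObjIsDefined_eq_top (top_le_iff.1 fun X _ => ?_)
    let c : l.obj (j.obj X) ⟶ X := adjl.counit.app X
    have hc : P (cokernel c) := by
      have : IsSplitEpi (j.map c) :=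
        IsSplitEpi.mk' ⟨adjl.unit.app (j.obj X), adjl.right_triangle_components X⟩
      exact (hP _).2 (IsZero.of_iso (isZero_cokernel_of_epi _) (PreservesCokernel.iso j c))
    refine leftAdjointObjIsDefined_of_bijective (Y := ⟨cokernel c, hc⟩) (cokernel.π c) fun Z =>
      ⟨fun f g h => P.ι.map_injective ((cancel_epi (cokernel.π c)).1 h), fun f => ?_⟩
    have hf : c ≫ f = 0 :=
      (adjl.homEquiv _ _).injective (((hP _).1 Z.property).eq_of_tgt _ _)
    exact ⟨P.homMk (cokernel.desc c f hf), cokernel.π_desc _ _ _⟩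
  have right : P.ι.IsLeftAdjoint := by
    refine Functor.isLeftAdjoint_of_rightAdjointObjIsDefined_eq_top (top_le_iff.1 fun X _ => ?_)
    let c : X ⟶ r.obj (j.obj X) := adjr.unit.app X
    have hc : P (kernel c) := by
      have : IsSplitMono (j.map c) :=
        IsSplitMono.mk' ⟨adjr.counit.app (j.obj X), adjr.left_triangle_components X⟩
      exact (hP _).2 (IsZero.of_iso (isZero_kernel_of_mono _) (PreservesKernel.iso j c))
    refine rightAdjointObjIsDefined_of_bijective (Y := ⟨kernel c, hc⟩) (kernel.ι c) fun Z =>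
      ⟨fun f g h => P.ι.map_injective ((cancel_mono (kernel.ι c)).1 h), fun f => ?_⟩
    have hf : f ≫ c = 0 :=
      (adjr.homEquiv _ _).symm.injective (((hP _).1 Z.property).eq_of_src _ _)
    exact ⟨P.homMk (kernel.lift c f hf), kernel.lift_ι _ _ _⟩
  have hker : ∀ X : P.FullSubcategory, functorKernel j (P.ι.obj X) :=
    fun X => (hP _).1 X.property
  let adjL := Adjunction.ofIsRightAdjoint P.ι
  let adjR := Adjunction.ofIsLeftAdjoint P.ι
  have := adjl.left_adjoint_additive
  have := adjr.right_adjoint_additive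
  have := adjL.left_adjoint_additive
  have := adjR.right_adjoint_additive
  exact ⟨{
    iUpper := P.ι.leftAdjoint
    iShriek := P.ι.rightAdjoint
    jShriek := l
    jLower := r
    additive_iLower := inferInstance
    additive_jUpper := inferInstance
    additive_iUpper := inferInstance
    additive_iShriek := inferInstance
    additive_jShriek := inferInstance
    additive_jLower := inferInstance
    adjJShriek := adjl
    adjJLower := adjr
    isIso_unit_j := inferInstance
    isIso_counit_j := inferInstance
    adjIUpper := adjL
    adjIShriek := adjR
    isIso_unit_i := inferInstance
    isIso_counit_i := inferInstance
    mem_kernel := hker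
    isEquivalence :=
      { faithful := inferInstance
        full := inferInstance
        essSurj := ⟨fun X => ⟨⟨X.obj, (hP _).2 X.property⟩, ⟨Iso.refl _⟩⟩⟩ } }⟩

end Recollement

/-! ### The trace pairing -/

section TracePairing

variable {K V W : Type*} [Field K] [AddCommGroup V] [Module K V] [Module.Finite K V]
  [AddCommGroup W] [Module K W] [Module.Finite K W]

/-- The trace pairing of `Hom(V, W)` and `Hom(W, V)` is nondegenerate. -/
lemma eq_zero_of_trace_comp_eq_zero {w : W →ₗ[K] V}
    (h : ∀ χ : V →ₗ[K] W, LinearMap.trace K W (χ ∘ₗ w) = 0) : w = 0 := by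
  refine LinearMap.ext fun x => (Module.forall_dual_apply_eq_zero_iff K (w x)).1 fun l => ?_
  have h' := h (l.smulRight x)
  have : (l.smulRight x : V →ₗ[K] W) ∘ₗ w = (l ∘ₗ w).smulRight x := by ext; simp
  rw [this, LinearMap.trace_smulRight] at h'
  simpa using h'

/-- The trace pairing of `Hom(V, W)` and `Hom(W, V)` is perfect. -/
lemma exists_eq_trace_comp (l : Module.Dual K (V →ₗ[K] W)) :
    ∃ w : W →ₗ[K] V, ∀ χ : V →ₗ[K] W, l χ = LinearMap.trace K W (χ ∘ₗ w) := by
  let B : (W →ₗ[K] V) →ₗ[K] Module.Dual K (V →ₗ[K] W) :=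
    (LinearMap.llcomp K W V W).flip.compr₂ (LinearMap.trace K W)
  have hB : Function.Injective B := by
    rw [← LinearMap.ker_eq_bot, LinearMap.ker_eq_bot']
    exact fun w hw => eq_zero_of_trace_comp_eq_zero fun χ => LinearMap.congr_fun hw χ
  have hB' : Function.Surjective B := by
    refine (LinearMap.injective_iff_surjective_of_finrank_eq_finrank ?_).1 hB
    rw [Subspace.dual_finrank_eq, Module.finrank_linearMap, Module.finrank_linearMap, mul_comm]
  obtain ⟨w, hw⟩ := hB' l
  exact ⟨w, fun χ => (LinearMap.congr_fun hw χ).symm⟩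

/-- The annihilator of the `G`-linear maps `V → W` under the trace pairing is spanned by the maps
`w - g⁻¹ w g`, with `w : W → V` linear. -/
lemma exists_eq_sum_sub_conj {G : Type*} [Group G] [Fintype G] (ρ : Representation K G V)
    (τ : Representation K G W) (v : W →ₗ[K] V)
    (hv : ∀ χ : V →ₗ[K] W, (∀ g, χ ∘ₗ ρ g = τ g ∘ₗ χ) → LinearMap.trace K W (χ ∘ₗ v) = 0) :
    ∃ w : G → (W →ₗ[K] V), ∑ g, (w g - ρ g⁻¹ ∘ₗ w g ∘ₗ τ g) = v := by
  let c : (G → (W →ₗ[K] V)) →ₗ[K] (W →ₗ[K] V) :=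
    { toFun w := ∑ g, (w g - ρ g⁻¹ ∘ₗ w g ∘ₗ τ g)
      map_add' w w' := by
        rw [← Finset.sum_add_distrib]
        refine Finset.sum_congr rfl fun g _ => ?_
        ext x; simp; abel
      map_smul' r w := by
        rw [RingHom.id_apply, Finset.smul_sum]
        refine Finset.sum_congr rfl fun g _ => ?_
        ext x; simp [smul_sub] }
  suffices v ∈ LinearMap.range c from this
  by_contra hvc
  obtain ⟨l, hlv, hl⟩ := Submodule.exists_le_ker_of_notMem hvc
  obtain ⟨χ, hχ⟩ := exists_eq_trace_comp l
  have htr (w : W →ₗ[K] V) : l w = LinearMap.trace K W (χ ∘ₗ w) := by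
    rw [hχ, LinearMap.trace_comp_comm']
  refine hlv ((htr v).trans (hv χ fun g => ?_))
  -- a functional that vanishes on `w - g⁻¹wg` for all `w` is the pairing with a `g`-linear map
  classical
  have key : χ - τ g ∘ₗ χ ∘ₗ ρ g⁻¹ = 0 := by
    refine eq_zero_of_trace_comp_eq_zero fun w => ?_
    have h₀ : l (c (Pi.single g w)) = 0 := hl ⟨_, rfl⟩
    have h₁ : c (Pi.single g w) = w - ρ g⁻¹ ∘ₗ w ∘ₗ τ g := by
      refine (Finset.sum_eq_single g (fun h _ hg => ?_) (by simp)).trans (by simp)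
      simp [Pi.single_eq_of_ne hg]
    rw [h₁, map_sub, sub_eq_zero, htr, htr] at h₀
    rw [LinearMap.trace_comp_comm', LinearMap.sub_comp, map_sub, h₀, sub_eq_zero]
    simp only [LinearMap.comp_assoc]
    rw [LinearMap.trace_comp_comm' (χ ∘ₗ ρ g⁻¹ ∘ₗ w) (τ g)]
    simp only [LinearMap.comp_assoc]
  have h := congrArg (· ∘ₗ ρ g) (sub_eq_zero.1 key)
  ext x
  simpa [← Module.End.mul_apply, ← map_mul] using LinearMap.congr_fun h x

end TracePairing

/-! ### Free modules and coherence of dual representable functors -/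

section DualRepresentable

variable {K : Type u} [Field K] {G : Type} [Group G]

/-- The free representation on a vector space `W`: the functions `G → W`, with `G` acting by
translation of the argument. -/
def freeRepresentation (W : Type*) [AddCommGroup W] [Module K W] : Representation K G (G → W) where
  toFun g := LinearMap.funLeft K W (g⁻¹ * ·)
  map_one' := by ext; simp [LinearMap.funLeft]
  map_mul' g h := by ext; simp [LinearMap.funLeft, mul_assoc]

/-- The linear map underlying a morphism of representations. -/
def linearMapOf {X Y : FDRep K G} (φ : X ⟶ Y) : X →ₗ[K] Y := φ.hom.hom.hom

lemma linearMapOf_comm {X Y : FDRep K G} (φ : X ⟶ Y) (g : G) :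
    linearMapOf φ ∘ₗ X.ρ g = Y.ρ g ∘ₗ linearMapOf φ :=
  congrArg (fun a => a.hom.hom) (φ.comm g)

/-- The morphism of representations given by an equivariant linear map. -/
def homOfLinearMap {X Y : FDRep K G} (f : X →ₗ[K] Y) (hf : ∀ g, f ∘ₗ X.ρ g = Y.ρ g ∘ₗ f) :
    X ⟶ Y where
  hom := ObjectProperty.homMk (ModuleCat.ofHom f)
  comm g := FGModuleCat.hom_ext (hf g)

variable [Fintype G]

variable (K G) in
/-- The free representation on a finite-dimensional vector space, as an object of `FDRep`. -/
def freeFDRep (W : Type u) [AddCommGroup W] [Module K W] [Module.Finite K W] : FDRep K G :=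
  FDRep.of (freeRepresentation (K := K) (G := G) W)

variable {W : Type u} [AddCommGroup W] [Module K W] [Module.Finite K W]

open Classical in
/-- The inclusion of `W` in the free representation on `W`: functions supported at `1`. -/
def freeUnit : W →ₗ[K] freeFDRep K G W := LinearMap.single K (fun _ : G => W) 1

/-- The linear map underlying `freeLift`. -/
def freeLiftLinearMap {X : FDRep K G} (v : W →ₗ[K] X) : (G → W) →ₗ[K] X where
  toFun f := ∑ h, X.ρ h (v (f h))
  map_add' f f' := by simp [Finset.sum_add_distrib]
  map_smul' r f := by simp [Finset.smul_sum]

/-- The extension of a linear map `W → X` to the free representation on `W`. -/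
def freeLift {X : FDRep K G} (v : W →ₗ[K] X) : freeFDRep K G W ⟶ X :=
  homOfLinearMap (freeLiftLinearMap v) fun g => by
    refine LinearMap.ext fun (f : G → W) => ?_
    change ∑ h, X.ρ h (v (f (g⁻¹ * h))) = X.ρ g (∑ h, X.ρ h (v (f h)))
    rw [map_sum, ← Equiv.sum_comp (Equiv.mulLeft g)]
    simp [map_mul]

lemma freeLift_freeUnit {X : FDRep K G} (v : W →ₗ[K] X) :
    linearMapOf (freeLift v) ∘ₗ freeUnit = v := by
  classical
  refine LinearMap.ext fun w => ?_
  change ∑ h, X.ρ h (v ((Pi.single 1 w : G → W) h)) = v w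
  rw [Finset.sum_eq_single 1 (fun h _ hh => by simp [hh]) (by simp)]
  simp

lemma free_hom_ext {X : FDRep K G} {φ ψ : freeFDRep K G W ⟶ X}
    (h : linearMapOf φ ∘ₗ freeUnit = linearMapOf ψ ∘ₗ freeUnit) : φ = ψ := by
  classical
  have key (g : G) (w : W) : linearMapOf φ (Pi.single g w : G → W) =
      linearMapOf ψ (Pi.single g w : G → W) := by
    have h₁ : (freeFDRep K G W).ρ g (Pi.single 1 w : G → W) = (Pi.single g w : G → W) := by
      funext x
      change (Pi.single 1 w : G → W) (g⁻¹ * x) = _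
      simp only [Pi.single_apply, inv_mul_eq_one, eq_comm]
    rw [← h₁]
    refine (LinearMap.congr_fun (linearMapOf_comm φ g) (Pi.single 1 w : G → W)).trans
      (Eq.trans ?_ (LinearMap.congr_fun (linearMapOf_comm ψ g) (Pi.single 1 w : G → W)).symm)
    exact congrArg (X.ρ g) (LinearMap.congr_fun h w)
  have : linearMapOf φ = linearMapOf ψ := LinearMap.pi_ext (φ := fun _ : G => W) key
  ext x
  exact LinearMap.congr_fun this x

/-- The functor `X ↦ Hom_G(X, M)^*` is coherent. Its generator is the functional
`χ ↦ tr(χ|_M)` on the `G`-maps `χ` from the free module on `M` to `M`, and its relations come from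
`exists_eq_sum_sub_conj`. -/
theorem isCoherent_dualHomFunctor (M : FDRep K G) :
    isCoherent K G (dualHomFunctor K M) := by
  rw [isCoherent_iff]
  refine ⟨isLinear_dualHomFunctor M, ?_⟩
  let L (X : FDRep K G) : (X ⟶ M) →ₗ[K] (X →ₗ[K] M) :=
    { toFun := linearMapOf
      map_add' _ _ := rfl
      map_smul' _ _ := rfl }
  have hL (X : FDRep K G) : Function.Injective (L X) := fun φ ψ h => by
    ext x
    exact LinearMap.congr_fun h x
  let T {X : FDRep K G} (v : M →ₗ[K] X) : Module.Dual K (X ⟶ M) :=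
    LinearMap.trace K M ∘ₗ LinearMap.lcomp K M v ∘ₗ L X
  let ξ : (dualHomFunctor K M).obj (freeFDRep K G M) :=
    (dualHomPairing K M _).symm (T freeUnit)
  have hξ {X : FDRep K G} (φ : freeFDRep K G M ⟶ X) :
      dualHomPairing K M X (((dualHomFunctor K M).map φ).hom.hom ξ) =
        T (linearMapOf φ ∘ₗ freeUnit) := rfl
  classical
  let i (g : G) : M →ₗ[K] freeFDRep K G (G → M) :=
    freeUnit ∘ₗ LinearMap.single K (fun _ : G => (M : Type u)) g
  let a : M →ₗ[K] freeFDRep K G (G → M) :=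
    ∑ g : G, (i g - (freeFDRep K G (G → M)).ρ g⁻¹ ∘ₗ i g ∘ₗ M.ρ g)
  have ha {X : FDRep K G} (ψ : freeFDRep K G (G → M) ⟶ X) :
      linearMapOf (freeLift a ≫ ψ) ∘ₗ freeUnit =
        ∑ g : G, (linearMapOf ψ ∘ₗ i g - X.ρ g⁻¹ ∘ₗ (linearMapOf ψ ∘ₗ i g) ∘ₗ M.ρ g) := by
    change linearMapOf ψ ∘ₗ linearMapOf (freeLift a) ∘ₗ freeUnit = _
    rw [freeLift_freeUnit]
    refine (map_sum (LinearMap.compRight K (linearMapOf ψ)) _ _).trans ?_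
    refine Finset.sum_congr rfl fun g _ => ?_
    change linearMapOf ψ ∘ₗ _ = _
    rw [LinearMap.comp_sub]
    exact congrArg (linearMapOf ψ ∘ₗ i g - ·) (LinearMap.ext fun m =>
      LinearMap.congr_fun (linearMapOf_comm ψ g⁻¹) (i g (M.ρ g m)))
  refine ⟨freeFDRep K G M, freeFDRep K G (G → M), freeLift a, ξ,
    ⟨fun X ζ => ?_, fun {X} φ => ?_⟩⟩
  · obtain ⟨l, hl⟩ := LinearMap.dualMap_surjective_of_injective (hL X) (dualHomPairing K M X ζ)
    obtain ⟨v, hv⟩ := exists_eq_trace_comp l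
    refine ⟨freeLift v, (dualHomPairing K M X).injective ?_⟩
    rw [hξ, freeLift_freeUnit, ← hl]
    exact LinearMap.ext fun χ => (hv (L X χ)).symm
  · rw [← (dualHomPairing K M X).map_eq_zero_iff, hξ]
    constructor
    · intro h
      obtain ⟨w, hw⟩ := exists_eq_sum_sub_conj X.ρ M.ρ (linearMapOf φ ∘ₗ freeUnit)
        fun χ hχ => LinearMap.congr_fun h (homOfLinearMap χ hχ)
      let v : (G → M) →ₗ[K] X := ∑ g : G, w g ∘ₗ LinearMap.proj g
      have hv (g : G) : linearMapOf (freeLift v) ∘ₗ i g = w g := by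
        rw [← LinearMap.comp_assoc, freeLift_freeUnit]
        ext m
        simp only [v, LinearMap.comp_apply, LinearMap.sum_apply]
        rw [Finset.sum_eq_single g (fun h _ hh => by simp [hh]) (by simp)]
        simp
      refine ⟨freeLift v, free_hom_ext ?_⟩
      rw [ha, ← hw]
      simp only [hv]
    · rintro ⟨ψ, rfl⟩
      rw [ha]
      refine LinearMap.ext fun χ => ?_
      refine (map_sum (LinearMap.trace K M ∘ₗ LinearMap.compRight K (linearMapOf χ)) _ _).trans
        (Finset.sum_eq_zero fun g _ => ?_)
      change LinearMap.trace K M (linearMapOf χ ∘ₗ _) = 0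
      have h : linearMapOf χ ∘ₗ X.ρ g⁻¹ ∘ₗ (linearMapOf ψ ∘ₗ i g) ∘ₗ M.ρ g =
          M.ρ g⁻¹ ∘ₗ (linearMapOf χ ∘ₗ linearMapOf ψ ∘ₗ i g) ∘ₗ M.ρ g :=
        LinearMap.ext fun m =>
          LinearMap.congr_fun (linearMapOf_comm χ g⁻¹) (linearMapOf ψ (i g (M.ρ g m)))
      rw [LinearMap.comp_sub, map_sub, h, LinearMap.trace_comp_comm' _ (M.ρ g⁻¹), sub_eq_zero]
      refine congrArg (LinearMap.trace K M) (LinearMap.ext fun m => ?_)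
      simp [← Module.End.mul_apply, ← map_mul]

end DualRepresentable

/-! ### Tensor powers are fully faithful -/

section TensorPowers

open Module

/-- For finite-dimensional spaces, `Hom(V, W)^{⊗ n} → Hom(V^{⊗ n}, W^{⊗ n})` takes the basis of
tensors of matrix units to the basis of matrix units. -/
lemma bijective_piTensorHomMap {K V W ι : Type*} [Field K] [AddCommGroup V] [Module K V]
    [Module.Finite K V] [AddCommGroup W] [Module K W] [Module.Finite K W] [Finite ι] :
    Function.Bijective (PiTensorProduct.piTensorHomMap :
      (⨂[K] _ : ι, (V →ₗ[K] W)) →ₗ[K] (⨂[K] _ : ι, V) →ₗ[K] ⨂[K] _ : ι, W) := by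
  classical
  have := Fintype.ofFinite ι
  let bV := finBasis K V
  let bW := finBasis K W
  let BV := Basis.piTensorProduct (fun _ : ι => bV)
  let BW := Basis.piTensorProduct (fun _ : ι => bW)
  let e := (Basis.piTensorProduct (fun _ : ι => bV.linearMap bW)).equiv (BV.linearMap BW)
    (Equiv.arrowProdEquivProdArrow ι _ _)
  suffices h : PiTensorProduct.piTensorHomMap = e.toLinearMap by
    rw [h]; exact e.bijective
  refine (Basis.piTensorProduct (fun _ : ι => bV.linearMap bW)).ext fun p => BV.ext fun q => ?_
  have h₁ : e (Basis.piTensorProduct (fun _ : ι => bV.linearMap bW) p) =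
    BV.linearMap BW (Equiv.arrowProdEquivProdArrow ι _ _ p) := Basis.equiv_apply _ _ _ _
  rw [LinearEquiv.coe_coe, h₁, Basis.linearMap_apply_apply, Basis.piTensorProduct_apply,
    Basis.piTensorProduct_apply, PiTensorProduct.piTensorHomMap_tprod_tprod]
  simp only [Basis.linearMap_apply_apply]
  split_ifs with h
  · rw [Basis.piTensorProduct_apply]
    congr 1
    funext i
    exact if_pos (congrFun h i)
  · obtain ⟨i, hi⟩ := Function.ne_iff.1 h
    exact (PiTensorProduct.tprod K).map_coord_zero i (if_neg hi)

variable {K : Type u} [Field K] {n : ℕ}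

instance (X Y : GammaCat K n) : Module.Finite K (X ⟶ Y) :=
  inferInstanceAs (Module.Finite K (dividedPower K n (X.space →ₗ[K] Y.space)))

instance : (tensorFunctor K n).Faithful where
  map_injective h := Subtype.ext (bijective_piTensorHomMap.1
    (congrArg linearMapOf h))

instance : (tensorFunctor K n).Full where
  map_surjective {X Y} φ := by
    obtain ⟨x, hx⟩ := bijective_piTensorHomMap.2
      (linearMapOf φ : (⨂[K] _ : Fin n, X.space) →ₗ[K] ⨂[K] _ : Fin n, Y.space)
    refine ⟨⟨x, fun σ => bijective_piTensorHomMap.1 ?_⟩, ?_⟩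
    · have h₁ := piTensorHomMap_tensorRep σ x
      have h₂ : PiTensorProduct.piTensorHomMap x ∘ₗ tensorRep K n X.space σ =
          tensorRep K n Y.space σ ∘ₗ PiTensorProduct.piTensorHomMap x := by
        rw [hx]; exact linearMapOf_comm φ σ
      have hσ : Function.Surjective (tensorRep K n X.space σ) :=
        ((tensorRep K n X.space).apply_bijective σ).2
      exact (LinearMap.cancel_right hσ).1 (h₁.trans h₂.symm)
    · ext y
      exact LinearMap.congr_fun hx y

end TensorPowers

/-! ### The partition of a function on `Fin n` -/

section Partitions

variable {n : ℕ}

lemma exists_equiv_of_map_univ_eq {α β γ : Type*} [Fintype α] [Fintype β] (f : α → γ) (g : β → γ)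
    (h : Finset.univ.val.map f = Finset.univ.val.map g) : ∃ e : α ≃ β, ∀ a, g (e a) = f a := by
  classical
  have e (c : γ) : Nonempty ({a // f a = c} ≃ {b // g b = c}) := by
    have := congrArg (Multiset.count c) h
    simp only [Multiset.count_map] at this
    refine ⟨Fintype.equivOfCardEq ?_⟩
    rw [Fintype.card_subtype, Fintype.card_subtype, Finset.card_def, Finset.card_def]
    simpa [eq_comm] using this
  exact ⟨Equiv.ofFiberEquiv fun c => (e c).some, fun a => Equiv.ofFiberEquiv_map _ a⟩

lemma card_index_fiber (c : Composition n) (i : Fin c.length) :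
    Fintype.card {j // c.index j = i} = c.blocksFun i := by
  rw [← Fintype.card_fin (c.blocksFun i)]
  refine (Fintype.card_congr ((Equiv.ofInjective _ (c.embedding i).injective).trans
    (Equiv.subtypeEquivRight fun j => ?_))).symm
  rw [c.mem_range_embedding_iff', eq_comm]

/-- Every function on `Fin n` becomes, after a permutation of `Fin n`, a function whose fibers are
the consecutive blocks of a partition of `n`. -/
lemma exists_comp_perm_eq_iff_index {κ : Type*} (v : Fin n → κ) :
    ∃ (lam : n.Partition) (σ : Equiv.Perm (Fin n)), ∀ i j, v (σ i) = v (σ j) ↔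
      (partitionComposition lam).index i = (partitionComposition lam).index j := by
  classical
  let v' : Fin n → Set.range v := Set.rangeFactorization v
  let m (a : Set.range v) : ℕ := Fintype.card {j // v' j = a}
  let lam : n.Partition :=
    { parts := Finset.univ.val.map m
      parts_pos {k} hk := by
        obtain ⟨⟨_, j, rfl⟩, -, rfl⟩ := Multiset.mem_map.1 hk
        exact Fintype.card_pos_iff.2 ⟨⟨j, rfl⟩⟩
      parts_sum := by
        have := Fintype.card_congr (Equiv.sigmaFiberEquiv v')
        rw [Fintype.card_sigma, Fintype.card_fin] at this
        exact this }
  let c := partitionComposition lam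
  have hc : Finset.univ.val.map c.blocksFun = Finset.univ.val.map m := by
    rw [Fin.univ_val_map, c.ofFn_blocksFun]
    exact Multiset.sort_eq lam.parts (· ≥ ·)
  obtain ⟨e, he⟩ := exists_equiv_of_map_univ_eq _ _ hc
  have hfib (a : Set.range v) : Nonempty ({j // e (c.index j) = a} ≃ {j // v' j = a}) := by
    refine ⟨Fintype.equivOfCardEq ?_⟩
    obtain ⟨i, rfl⟩ := e.surjective a
    simp only [e.apply_eq_iff_eq]
    rw [card_index_fiber, ← he]
  refine ⟨lam, Equiv.ofFiberEquiv fun a => (hfib a).some, fun i j => ?_⟩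
  have h (i : Fin n) : v (Equiv.ofFiberEquiv (fun a => (hfib a).some) i) = e (c.index i) :=
    congrArg Subtype.val (Equiv.ofFiberEquiv_map (fun a => (hfib a).some) i)
  rw [h, h, Subtype.val_injective.eq_iff, e.apply_eq_iff_eq]

end Partitions

/-! ### Objects covered by a family -/

section Covers

variable {D : Type*} [Category D] [Preadditive D]

/-- The identity of `X` is a finite sum of maps that factor through members of the family `Y`
(with repetitions allowed). -/
def IsCoveredBy {ι : Type*} (Y : ι → D) (X : D) : Prop :=
  ∃ (κ : Type) (_ : Fintype κ) (k : κ → ι) (f : ∀ a, X ⟶ Y (k a)) (g : ∀ a, Y (k a) ⟶ X),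
    ∑ a, f a ≫ g a = 𝟙 X

lemma IsCoveredBy.isZero_obj {ι : Type*} {Y : ι → D} {X : D} (h : IsCoveredBy Y X)
    {E : Type*} [Category E] [Preadditive E] (F : D ⥤ E) [F.Additive]
    (hY : ∀ i, IsZero (F.obj (Y i))) : IsZero (F.obj X) := by
  obtain ⟨κ, _, k, f, g, hfg⟩ := h
  rw [IsZero.iff_id_eq_zero, ← F.map_id, ← hfg, F.map_sum]
  refine Finset.sum_eq_zero fun a _ => ?_
  rw [F.map_comp, (hY (k a)).eq_of_tgt (F.map (f a)) 0, zero_comp]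

end Covers

/-! ### Permutation modules -/

section PermutationModules

open Module

variable {K : Type u} [Field K] {G : Type} [Group G] {Q Ω : Type} [MulAction G Q] [MulAction G Ω]
  {N M : FDRep K G}

/-- The group permutes the basis `B` of `M` through its action on the index set. -/
structure IsPermutationBasis (B : Basis Ω K M) : Prop where
  smul (g : G) (v : Ω) : M.ρ g (B v) = B (g • v)

variable {C : Basis Q K N} {B : Basis Ω K M}

/-- An equivariant injection between permuted bases makes the smaller permutation module a
retract; the complementary projection kills the remaining basis vectors. -/
lemma IsPermutationBasis.exists_inclusion_projection (hC : IsPermutationBasis C)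
    (hB : IsPermutationBasis B) (o : Q → Ω) (ho : ∀ (g : G) q, o (g • q) = g • o q)
    (hinj : Function.Injective o) :
    ∃ (i : N ⟶ M) (p : M ⟶ N), i ≫ p = 𝟙 N ∧
      (∀ q, linearMapOf (p ≫ i) (B (o q)) = B (o q)) ∧
      ∀ v, v ∉ Set.range o → linearMapOf (p ≫ i) (B v) = 0 := by
  let i : N ⟶ M := homOfLinearMap (C.constr K (B ∘ o)) fun g => C.ext fun q => by
    simp [hC.smul, hB.smul, ho]
  let p : M ⟶ N := homOfLinearMap (B.constr K (Function.extend o C 0)) fun g => B.ext fun v => by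
    simp only [LinearMap.comp_apply, hB.smul, Basis.constr_basis]
    by_cases hv : ∃ q, o q = v
    · obtain ⟨q, rfl⟩ := hv
      rw [← ho, hinj.extend_apply, hinj.extend_apply, hC.smul]
    · have hv' : ¬ ∃ q, o q = g • v := by
        rintro ⟨q, hq⟩
        exact hv ⟨g⁻¹ • q, by rw [ho, hq, inv_smul_smul]⟩
      rw [Function.extend_apply' _ _ _ hv, Function.extend_apply' _ _ _ hv']
      simp
  have hi (q : Q) : linearMapOf i (C q) = B (o q) := C.constr_basis K _ q
  have hp (v : Ω) : linearMapOf p (B v) = Function.extend o C 0 v := B.constr_basis K _ v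
  refine ⟨i, p, ?_, fun q => ?_, fun v hv => ?_⟩
  · have h : linearMapOf (i ≫ p) = LinearMap.id := C.ext fun q => by
      change linearMapOf p (linearMapOf i (C q)) = C q
      rw [hi, hp, hinj.extend_apply]
    ext x
    exact LinearMap.congr_fun h x
  · change linearMapOf i (linearMapOf p (B (o q))) = _
    rw [hp, hinj.extend_apply, hi]
  · change linearMapOf i (linearMapOf p (B v)) = _
    rw [hp, Function.extend_apply' _ _ _ hv]
    exact map_zero _

variable {H : Subgroup G} {w : Ω}

/-- The identification of `G ⧸ H` with the orbit of a point `w` with stabilizer `H`. -/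
def orbitMap (hw : ∀ g, g ∈ H ↔ g • w = w) (q : G ⧸ H) : Ω :=
  Quotient.liftOn' q (· • w) fun a b h => by
    have := (hw _).1 (QuotientGroup.leftRel_apply.1 h)
    rw [mul_smul, inv_smul_eq_iff] at this
    exact this.symm

variable (hw : ∀ g, g ∈ H ↔ g • w = w)

lemma orbitMap_smul (g : G) (q : G ⧸ H) : orbitMap hw (g • q) = g • orbitMap hw q := by
  induction q using QuotientGroup.induction_on with
  | H a => exact mul_smul g a w

lemma orbitMap_injective : Function.Injective (orbitMap hw) := by
  intro p q h
  induction p using QuotientGroup.induction_on with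
  | H a =>
    induction q using QuotientGroup.induction_on with
    | H b =>
      refine QuotientGroup.eq.2 ((hw _).2 ?_)
      rw [mul_smul, inv_smul_eq_iff]
      exact h.symm

lemma mem_range_orbitMap {v : Ω} : v ∈ Set.range (orbitMap hw) ↔ v ∈ MulAction.orbit G w := by
  constructor
  · rintro ⟨q, rfl⟩
    induction q using QuotientGroup.induction_on with
    | H a => exact ⟨a, rfl⟩
  · rintro ⟨a, rfl⟩
    exact ⟨(a : G ⧸ H), rfl⟩

/-- If every stabilizer of a permuted basis is conjugate to some `H i`, the orbit decomposition
writes the identity as a sum of maps through the modules `K[G/H i]`. -/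
theorem IsPermutationBasis.isCoveredBy [Finite Ω] (hB : IsPermutationBasis B) {ι : Type*}
    {H : ι → Subgroup G} {Y : ι → FDRep K G} {C : ∀ i, Basis (G ⧸ H i) K (Y i)}
    (hC : ∀ i, IsPermutationBasis (C i))
    (hstab : ∀ v : Ω, ∃ (i : ι) (g : G), ∀ h, h ∈ H i ↔ h • g • v = g • v) :
    IsCoveredBy Y M := by
  classical
  have := Fintype.ofFinite Ω
  let κ := MulAction.orbitRel.Quotient G Ω
  have hrep (a : κ) : ∃ (w : Ω) (i : ι), Quotient.mk _ w = a ∧ ∀ h, h ∈ H i ↔ h • w = w := by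
    obtain ⟨v, rfl⟩ := Quotient.exists_rep a
    obtain ⟨i, g, hg⟩ := hstab v
    exact ⟨g • v, i, Quotient.sound ⟨g, rfl⟩, hg⟩
  choose w k hwa hw using hrep
  choose f g hfg h₁ h₂ using fun a => (hC (k a)).exists_inclusion_projection hB
    (orbitMap (hw a)) (orbitMap_smul (hw a)) (orbitMap_injective (hw a))
  refine ⟨κ, inferInstance, k, g, f, ?_⟩
  have hmem (a : κ) (v : Ω) : v ∈ Set.range (orbitMap (hw a)) ↔ Quotient.mk _ v = a := by
    rw [mem_range_orbitMap]
    conv_rhs => rw [← hwa a]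
    exact (Quotient.eq (r := MulAction.orbitRel G Ω)).symm
  have hid : linearMapOf (∑ a, g a ≫ f a) = LinearMap.id := B.ext fun v => by
    let L : (M ⟶ M) →+ (M →ₗ[K] M) :=
      { toFun := linearMapOf, map_zero' := rfl, map_add' := fun _ _ => rfl }
    have hL : linearMapOf (∑ a, g a ≫ f a) = ∑ a, linearMapOf (g a ≫ f a) := map_sum L _ _
    rw [hL, LinearMap.sum_apply, Finset.sum_eq_single (Quotient.mk _ v)]
    · obtain ⟨q, hq⟩ := (hmem (Quotient.mk _ v) v).2 rfl
      have := h₁ (Quotient.mk _ v) q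
      rwa [hq] at this
    · intro a _ ha
      exact h₂ a v fun hv => ha ((hmem a v).1 hv).symm
    · simp
  ext x
  exact LinearMap.congr_fun hid x

end PermutationModules

/-! ### Young permutation modules and tensor powers -/

section Young

open Module

variable {K : Type u} [Field K] {n : ℕ}

attribute [local instance] arrowAction

variable (K) in
/-- The cosets as a basis of the Young permutation module. -/
def youngBasis (lam : n.Partition) :
    Basis (Equiv.Perm (Fin n) ⧸ youngSubgroup lam) K (youngModule K lam) :=
  MonoidAlgebra.basis (Equiv.Perm (Fin n) ⧸ youngSubgroup lam) K

lemma isPermutationBasis_youngBasis (lam : n.Partition) :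
    IsPermutationBasis (youngBasis K lam) where
  smul g q := Representation.ofMulAction_single g q 1

/-- The basis of `V^{⊗ n}` formed by the tensors of basis vectors of `V`. -/
def tensorBasis {κ : Type} (V : GammaCat K n) (b : Basis κ K V.space) :
    Basis (Fin n → κ) K ((tensorFunctor K n).obj V) :=
  Basis.piTensorProduct fun _ => b

lemma isPermutationBasis_tensorBasis {κ : Type} (V : GammaCat K n) (b : Basis κ K V.space) :
    IsPermutationBasis (tensorBasis V b) where
  smul σ v := by
    have h (v : Fin n → κ) : tensorBasis V b v = PiTensorProduct.tprod K fun i => b (v i) :=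
      Basis.piTensorProduct_apply _ v
    rw [h, h]
    exact tensorRep_tprod K V.space σ _

lemma mem_youngSubgroup_iff {κ : Type} {v : Fin n → κ} {lam : n.Partition}
    (hv : ∀ i j, v i = v j ↔
      (partitionComposition lam).index i = (partitionComposition lam).index j)
    (σ : Equiv.Perm (Fin n)) : σ ∈ youngSubgroup lam ↔ σ • v = v := by
  rw [← inv_mem_iff]
  constructor
  · exact fun h => funext fun i => (hv _ _).2 (h i)
  · exact fun h i => (hv _ _).1 (congrFun h i)

/-- The identity of `V^{⊗ n}` is a sum of maps that factor through Young permutation modules. -/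
theorem isCoveredBy_youngModule (V : GammaCat K n) :
    IsCoveredBy (fun lam : n.Partition => youngModule K lam) ((tensorFunctor K n).obj V) := by
  refine (isPermutationBasis_tensorBasis V (finBasis K V.space)).isCoveredBy
    isPermutationBasis_youngBasis fun v => ?_
  obtain ⟨lam, σ, h⟩ := exists_comp_perm_eq_iff_index v
  exact ⟨lam, σ⁻¹, mem_youngSubgroup_iff h⟩

variable (K n) in
/-- The space `Kⁿ` as an object of `Γⁿ V`. -/
def standardSpace : GammaCat K n := ⟨FGModuleCat.of K (Fin n → K)⟩

/-- A partition of `n` has at most `n` parts, so the vector `e₁^{⊗ n₁} ⊗ e₂^{⊗ n₂} ⊗ ⋯` exists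
in `(Kⁿ)^{⊗ n}`, and its orbit spans the Young permutation module. -/
theorem exists_retract_standardSpace (lam : n.Partition) :
    ∃ (i : youngModule K lam ⟶ (tensorFunctor K n).obj (standardSpace K n))
      (p : (tensorFunctor K n).obj (standardSpace K n) ⟶ youngModule K lam), i ≫ p = 𝟙 _ := by
  let c := partitionComposition lam
  let v : Fin n → Fin n := fun i => Fin.castLE c.length_le (c.index i)
  have hv := mem_youngSubgroup_iff (v := v) (lam := lam) fun i j =>
    (Fin.castLE_injective c.length_le).eq_iff
  obtain ⟨i, p, h, -⟩ := (isPermutationBasis_youngBasis lam).exists_inclusion_projection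
    (isPermutationBasis_tensorBasis (standardSpace K n) (Pi.basisFun K (Fin n)))
    (orbitMap hv) (orbitMap_smul hv) (orbitMap_injective hv)
  exact ⟨i, p, h⟩

/-- The space `Kⁿ` generates `Γⁿ V`: every identity is a sum of maps that factor through it. -/
theorem exists_sum_comp_eq_id (V : GammaCat K n) :
    ∃ (κ : Type) (_ : Fintype κ) (f : κ → (V ⟶ standardSpace K n))
      (g : κ → (standardSpace K n ⟶ V)), ∑ a, f a ≫ g a = 𝟙 V := by
  obtain ⟨κ, _, k, f, g, h⟩ := isCoveredBy_youngModule V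
  choose i p hip using exists_retract_standardSpace (K := K) (n := n)
  refine ⟨κ, inferInstance, fun a => (tensorFunctor K n).preimage (f a ≫ i (k a)),
    fun a => (tensorFunctor K n).preimage (p (k a) ≫ g a), (tensorFunctor K n).map_injective ?_⟩
  rw [Functor.map_sum, CategoryTheory.Functor.map_id, ← h]
  refine Finset.sum_congr rfl fun a _ => ?_
  rw [Functor.map_comp, Functor.map_preimage, Functor.map_preimage, Category.assoc,
    reassoc_of% hip (k a)]

end Young

/-! ### Strict polynomial functors and the adjoints of `j^*` -/

section StrictPolynomialFunctors

variable {K : Type u} [Field K] {n : ℕ}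

/-- The strict polynomial functor `Hom(U, -)` (a divided power). -/
def polyHom (U : GammaCat K n) : StrictPolyFunctor K n := ⟨homFunctor K U, isLinear_homFunctor U⟩

/-- The strict polynomial functor `Hom(-, U)^*` (a symmetric power). -/
def polyDualHom (U : GammaCat K n) : StrictPolyFunctor K n :=
  ⟨dualHomFunctor K U, isLinear_dualHomFunctor U⟩

/-- The coherent functor `h_M`. -/
def cohHom (M : FDRep K (Equiv.Perm (Fin n))) : Coh K n := ⟨hFunctor K _ M, isCoherent_hFunctor M⟩

/-- The coherent functor `X ↦ Hom(X, M)^*`. -/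
def cohDualHom (M : FDRep K (Equiv.Perm (Fin n))) : Coh K n :=
  ⟨dualHomFunctor K M, isCoherent_dualHomFunctor M⟩

lemma eq_zero_of_app_standardSpace_eq_zero {F F' : StrictPolyFunctor K n} {η : F ⟶ F'}
    (h : ∀ x, (η.hom.app (standardSpace K n)).hom.hom x = 0) : η = 0 := by
  refine ObjectProperty.hom_ext _ (natTrans_ext_apply fun X x => ?_)
  obtain ⟨κ, _, f, g, hfg⟩ := exists_sum_comp_eq_id X
  rw [← map_id_apply F.obj x, ← hfg, map_sum_apply F.property, map_sum]
  refine Finset.sum_eq_zero fun a _ => ?_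
  rw [map_comp_apply, naturality_apply, h, map_zero]

lemma exists_epi_coproduct_polyHom (F : StrictPolyFunctor K n) :
    ∃ (d : ℕ) (e : (∐ fun _ : Fin d => polyHom (standardSpace K n)) ⟶ F), Epi e := by
  let b := Module.finBasis K (F.obj.obj (standardSpace K n))
  let φ (k) : polyHom (standardSpace K n) ⟶ F :=
    ObjectProperty.homMk ((homFunctorEquiv _ F.property).symm (b k))
  refine ⟨_, Sigma.desc φ, Preadditive.epi_of_cancel_zero _ fun {F'} η hη => ?_⟩
  have h (k) : (η.hom.app (standardSpace K n)).hom.hom (b k) = 0 := by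
    have h₁ : φ k ≫ η = 0 := by
      rw [← Sigma.ι_desc φ k, Category.assoc, hη, comp_zero]
    have h₂ := congrArg (fun θ => (θ.hom.app (standardSpace K n)).hom.hom (𝟙 _)) h₁
    refine Eq.trans (congrArg _ (map_id_apply F.obj (b k)).symm) h₂
  have h' : (η.hom.app (standardSpace K n)).hom.hom = 0 := b.ext h
  exact eq_zero_of_app_standardSpace_eq_zero (LinearMap.congr_fun h')

lemma exists_mono_product_polyDualHom (F : StrictPolyFunctor K n) :
    ∃ (d : ℕ) (e : F ⟶ ∏ᶜ fun _ : Fin d => polyDualHom (standardSpace K n)), Mono e := by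
  let b := Module.finBasis K (F.obj.obj (standardSpace K n))
  let φ (k) : F ⟶ polyDualHom (standardSpace K n) :=
    ObjectProperty.homMk ((dualHomFunctorEquiv _ F.property).symm (b.coord k))
  refine ⟨_, Pi.lift φ, Preadditive.mono_of_cancel_zero _ fun {F'} η hη => ?_⟩
  refine eq_zero_of_app_standardSpace_eq_zero fun x => b.ext_elem fun k => ?_
  have h₁ : η ≫ φ k = 0 := by
    rw [← Pi.lift_π φ k, ← Category.assoc, hη, zero_comp]
  have h₂ := congrArg (fun θ => dualHomPairing K (standardSpace K n) _
    ((θ.hom.app (standardSpace K n)).hom.hom x) (𝟙 _)) h₁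
  refine (Eq.trans (congrArg (b.coord k) (map_id_apply F.obj _).symm) h₂).trans ?_
  simp
  rfl

/-- The map `Hom(U, -) ⟶ j^* Hom(U^{⊗ n}, -)` given by the functor `V ↦ V^{⊗ n}` on morphisms. -/
def polyHomUnit (U : GammaCat K n) :
    polyHom U ⟶ (jStar K n).obj (cohHom ((tensorFunctor K n).obj U)) :=
  ObjectProperty.homMk ((homFunctorEquiv U ((jStar K n).obj _).property).symm
    (𝟙 ((tensorFunctor K n).obj U)))

lemma polyHomUnit_app (U X : GammaCat K n) (φ : U ⟶ X) :
    ((polyHomUnit U).hom.app X).hom.hom φ = (tensorFunctor K n).map φ :=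
  Category.id_comp ((tensorFunctor K n).map φ)

instance (U : GammaCat K n) : IsIso (polyHomUnit U) := by
  have hm : Mono ((isLinear K (GammaCat K n)).ι.map (polyHomUnit U)) :=
    mono_iff_injective_app.2 fun X φ ψ h => (tensorFunctor K n).map_injective
      ((polyHomUnit_app U X φ).symm.trans (h.trans (polyHomUnit_app U X ψ)))
  have he : Epi ((isLinear K (GammaCat K n)).ι.map (polyHomUnit U)) :=
    epi_iff_surjective_app.2 fun X φ =>
      ⟨(tensorFunctor K n).preimage φ, (polyHomUnit_app U X _).trans (Functor.map_preimage _ _)⟩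
  have := isIso_of_mono_of_epi ((isLinear K (GammaCat K n)).ι.map (polyHomUnit U))
  exact isIso_of_fully_faithful (isLinear K (GammaCat K n)).ι _

/-- Both sides are `f(U^{⊗ n})` by the Yoneda lemma. -/
lemma bijective_polyHomUnit_comp (U : GammaCat K n) (f : Coh K n) :
    Function.Bijective fun g : cohHom ((tensorFunctor K n).obj U) ⟶ f =>
      polyHomUnit U ≫ (jStar K n).map g := by
  let T := tensorFunctor K n
  let e₁ : (cohHom (T.obj U) ⟶ f) ≃ f.obj.obj (T.obj U) :=
    ((isCoherent K _).fullyFaithfulι.homEquiv (X := cohHom (T.obj U)) (Y := f)).trans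
      (homFunctorEquiv (T.obj U) f.property.1)
  let e₂ : (polyHom U ⟶ (jStar K n).obj f) ≃ f.obj.obj (T.obj U) :=
    ((isLinear K _).fullyFaithfulι.homEquiv (X := polyHom U) (Y := (jStar K n).obj f)).trans
      (homFunctorEquiv U ((jStar K n).obj f).property)
  have h (g) : e₂ (polyHomUnit U ≫ (jStar K n).map g) = e₁ g :=
    congrArg (g.hom.app (T.obj U)).hom.hom ((polyHomUnit_app U U (𝟙 U)).trans (T.map_id U))
  refine (Equiv.comp_bijective _ e₂).1 ?_
  convert e₁.bijective using 1
  exact funext h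

/-- The map `j^* Hom(-, U^{⊗ n})^* ⟶ Hom(-, U)^*` dual to the functor `V ↦ V^{⊗ n}` on morphisms. -/
def polyDualHomCounit (U : GammaCat K n) :
    (jStar K n).obj (cohDualHom ((tensorFunctor K n).obj U)) ⟶ polyDualHom U :=
  ObjectProperty.homMk ((dualHomFunctorEquiv U ((jStar K n).obj _).property).symm
    (dualHomFunctorEquiv ((tensorFunctor K n).obj U) (isLinear_dualHomFunctor _) (𝟙 _)))

/-- Both sides are the dual of `f(U^{⊗ n})` by the dual Yoneda lemma. -/
lemma bijective_comp_polyDualHomCounit (U : GammaCat K n) (f : Coh K n) :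
    Function.Bijective fun g : f ⟶ cohDualHom ((tensorFunctor K n).obj U) =>
      (jStar K n).map g ≫ polyDualHomCounit U := by
  let T := tensorFunctor K n
  let e₁ : (f ⟶ cohDualHom (T.obj U)) ≃ Module.Dual K (f.obj.obj (T.obj U)) :=
    ((isCoherent K _).fullyFaithfulι.homEquiv (X := f) (Y := cohDualHom (T.obj U))).trans
      (dualHomFunctorEquiv (T.obj U) f.property.1)
  let e₂ : ((jStar K n).obj f ⟶ polyDualHom U) ≃ Module.Dual K (f.obj.obj (T.obj U)) :=
    ((isLinear K _).fullyFaithfulι.homEquiv (X := (jStar K n).obj f) (Y := polyDualHom U)).trans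
      (dualHomFunctorEquiv U ((jStar K n).obj f).property)
  have h (g) : e₂ ((jStar K n).map g ≫ polyDualHomCounit U) = e₁ g :=
    LinearMap.ext fun y => congrArg
      (dualHomFunctorEquiv (T.obj U) (isLinear_dualHomFunctor (T.obj U)) (𝟙 _))
      (map_id_apply ((jStar K n).obj (cohDualHom (T.obj U))).obj
        ((g.hom.app (T.obj U)).hom.hom y))
  refine (Equiv.comp_bijective _ e₂).1 ?_
  convert e₁.bijective using 1
  exact funext h

instance : (jStar K n).IsRightAdjoint :=
  Functor.isRightAdjoint_of_leftAdjointObjIsDefined_eq_top (top_le_iff.1 fun F _ =>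
    have : (jStar K n).leftAdjointObjIsDefined.IsClosedUnderFiniteCoproducts :=
      { isClosedUnderColimitsOfShape := fun _ _ => inferInstance }
    prop_of_coproduct_presentation _
      (leftAdjointObjIsDefined_of_bijective _ (bijective_polyHomUnit_comp (standardSpace K n)))
      exists_epi_coproduct_polyHom F)

instance : (jStar K n).IsLeftAdjoint :=
  Functor.isLeftAdjoint_of_rightAdjointObjIsDefined_eq_top (top_le_iff.1 fun F _ =>
    have : (jStar K n).rightAdjointObjIsDefined.IsClosedUnderFiniteProducts :=
      { isClosedUnderLimitsOfShape := fun _ _ => inferInstance }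
    prop_of_product_copresentation _
      (rightAdjointObjIsDefined_of_bijective _
        (bijective_comp_polyDualHomCounit (standardSpace K n)))
      exists_mono_product_polyDualHom F)

lemma isIso_unit_jStar {L : StrictPolyFunctor K n ⥤ Coh K n} (adj : L ⊣ jStar K n) :
    IsIso adj.unit := by
  have := adj.isLeftAdjoint
  have (J : Type) [SmallCategory J] [FinCategory J] :=
    isClosedUnderColimitsOfShape_isIso_app adj.unit J
  have : ObjectProperty.IsClosedUnderFiniteCoproducts fun F => IsIso (adj.unit.app F) :=
    { isClosedUnderColimitsOfShape := fun J _ => by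
        have := Fintype.ofFinite J
        classical
        infer_instance }
  have h := prop_of_coproduct_presentation (fun F => IsIso (adj.unit.app F))
    (isIso_unit_app_of_bijective adj _ (bijective_polyHomUnit_comp (standardSpace K n)))
    exists_epi_coproduct_polyHom
  exact NatIso.isIso_of_isIso_app _

instance : (jStar K n).Additive where
  map_add := rfl

theorem isZero_jStar_obj_iff (f : Coh K n) :
    IsZero ((jStar K n).obj f) ↔ ∀ lam : n.Partition, IsZero (f.obj.obj (youngModule K lam)) := by
  have hadd := f.property.1.1
  constructor
  · intro h lam
    -- `K[S_n/S_λ]` is a retract of `(Kⁿ)^{⊗ n}`, at which `f` vanishes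
    obtain ⟨i, p, hip⟩ := exists_retract_standardSpace (K := K) lam
    let E : StrictPolyFunctor K n ⥤ FGModuleCat.{u} K :=
      (isLinear K (GammaCat K n)).ι ⋙ (evaluation _ _).obj (standardSpace K n)
    have hE : E.Additive := ⟨rfl⟩
    have hz : IsZero (f.obj.obj ((tensorFunctor K n).obj (standardSpace K n))) :=
      E.map_isZero h
    rw [IsZero.iff_id_eq_zero, ← CategoryTheory.Functor.map_id, ← hip, Functor.map_comp,
      hz.eq_of_tgt (f.obj.map i) 0, zero_comp]
  · intro h
    rw [IsZero.iff_id_eq_zero]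
    refine ObjectProperty.hom_ext _ (natTrans_ext_apply fun V x => ?_)
    -- `V^{⊗ n}` is covered by the modules `K[S_n/S_λ]`, on which `f` vanishes
    exact congrArg (fun a => a.hom.hom x)
      (((isCoveredBy_youngModule V).isZero_obj f.obj h).eq_of_src (𝟙 _) 0)

lemma vanishesOnYoung_eq :
    vanishesOnYoung K n =
      ObjectProperty.inverseImage (IsZero (C := StrictPolyFunctor K n)) (jStar K n) := by
  ext f
  exact (isZero_jStar_obj_iff f).symm

variable (K n) in
theorem isAbelianCategory_cohYoung : IsAbelianCategory (CohYoung K n) := by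
  have : (vanishesOnYoung K n).ContainsZero :=
    ⟨0, isZero_zero _, (isZero_jStar_obj_iff _).1 ((jStar K n).map_isZero (isZero_zero _))⟩
  have : (vanishesOnYoung K n).IsClosedUnderSubobjects := by
    rw [vanishesOnYoung_eq]; infer_instance
  have : (vanishesOnYoung K n).IsClosedUnderQuotients := by
    rw [vanishesOnYoung_eq]; infer_instance
  have : (vanishesOnYoung K n).IsClosedUnderFiniteProducts :=
    { isClosedUnderLimitsOfShape := fun J _ => ⟨by
        rintro f ⟨q⟩
        have hq := isLimitOfPreserves (jStar K n) q.isLimit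
        refine (isZero_jStar_obj_iff f).1 ((IsZero.iff_id_eq_zero _).2 (hq.hom_ext fun a => ?_))
        exact ((isZero_jStar_obj_iff _).2 (q.prop_diag_obj a)).eq_of_tgt _ _⟩ }
  exact ⟨inferInstance, rfl⟩

end StrictPolynomialFunctors

end CoherentPoly

end

theorem mainTheorem1 {K : Type u} [Field K] (p : ℕ) [Fact p.Prime] [CharP K p]
    (n : ℕ) (hn : 0 < n) :
    CoherentPoly.IsAbelianCategory (CoherentPoly.CohYoung K n) ∧
    CoherentPoly.IsAbelianCategory (CoherentPoly.Coh K n) ∧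
    CoherentPoly.IsAbelianCategory (CoherentPoly.StrictPolyFunctor K n) ∧
    CoherentPoly.IsExactFunctor (CoherentPoly.jStar K n) ∧
    (∀ f : CoherentPoly.Coh K n,
      CoherentPoly.functorKernel (CoherentPoly.jStar K n) f ↔
        ∀ lam : n.Partition, CategoryTheory.Limits.IsZero
          (f.obj.obj (CoherentPoly.youngModule K lam))) ∧
    Nonempty (CoherentPoly.Recollement
      (CoherentPoly.vanishesOnYoung K n).ι (CoherentPoly.jStar K n)) := by
  let adjl := Adjunction.ofIsRightAdjoint (CoherentPoly.jStar K n)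
  let adjr := Adjunction.ofIsLeftAdjoint (CoherentPoly.jStar K n)
  have := CoherentPoly.isIso_unit_jStar adjl
  exact ⟨CoherentPoly.isAbelianCategory_cohYoung K n, CoherentPoly.isAbelianCategory_coherent _ _,
    CoherentPoly.isAbelianCategory_linear _ _, ⟨inferInstance, inferInstance⟩,
    CoherentPoly.isZero_jStar_obj_iff,
    CoherentPoly.nonempty_recollement _ (fun f => (CoherentPoly.isZero_jStar_obj_iff f).symm)
      adjl adjr⟩
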